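/- Let $k$ be a field of characteristic $\neq 2$, let $K = k(t)$ be the rational function field in one variable over $k$, and let $V_{K/k}$ be the set of (nontrivial) discrete valuations on $K$ that are trivial on $k$. All quadratic forms are finite-dimensional and regular (nondegenerate). For $v \in V_{K/k}$ let $K_v$ denote the $v$-adic completion of $K$, and write $\langle\langle a_1,\dots,a_n\rangle\rangle = \langle 1,a_1\rangle\otimes\cdots\otimes\langle 1,a_n\rangle$ ($n \ge 0$, $a_i \in K^\times$) for an $n$-fold Pfister form. A quadratic form $q$ over $K$ is a Pfister neighbor if there are a Pfister form $\varphi$ over $K$ with $\dim\varphi < 2\dim q$, an element $a \in K^\times$ and a quadratic form $\psi$ over $K$ such that $\varphi \simeq aq \perp \psi$. Say that $q$ satisfies the Hasse principle for isotropy with respect to $V_{K/k}$ if the following implication holds: if $q$ is isotropic over $K_v$ for every $v \in V_{K/k}$, then $q$ is isotropic over $K$. Then: (a) The Hasse principle for isometry holds over $K$ with respect to $V_{K/k}$: if $q_1, q_2$ are quadratic forms over $K$ that are isometric over $K_v$ for every $v \in V_{K/k}$, then $q_1$ and $q_2$ are isometric over $K$. (b) Every Pfister neighbor over $K$ satisfies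 the Hasse principle for isotropy with respect to $V_{K/k}$. (c) The following forms over $K$ satisfy the Hasse principle for isotropy with respect to $V_{K/k}$: every Pfister form, every regular quadratic form of dimension $2$ or $3$, and every regular quadratic form of dimension $4$ with trivial determinant (i.e. whose determinant is a square in $K^\times$). -/

import Mathlib

open scoped TensorProduct

universe u v w

noncomputable section

namespace HasseQF

section Forms

variable {F : Type u} [Field F]

/-- A quadratic form is regular (nondegenerate) if its radical is zero; as `2` is invertible, this
says that the associated symmetric bilinear form is nondegenerate. -/
def IsRegular {E : Type v} [AddCommGroup E] [Module F E] (Q : QuadraticForm F E) : Prop :=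
  Q.Nondegenerate

/-- A quadratic form is isotropic if it has a nontrivial zero. -/
def IsIsotropic {E : Type v} [AddCommGroup E] [Module F E] (Q : QuadraticForm F E) : Prop :=
  ∃ x : E, x ≠ 0 ∧ Q x = 0

/-- The Pfister form `⟨⟨a₁, …, aₙ⟩⟩ = ⟨1, a₁⟩ ⊗ ⋯ ⊗ ⟨1, aₙ⟩`, together with its underlying space.
The `0`-fold Pfister form (the empty tensor product) is `⟨1⟩`. -/
def pfister [Invertible (2 : F)] : List Fˣ → QuadraticModuleCat.{u} F
  | [] => QuadraticModuleCat.of (QuadraticMap.sq (R := F) (A := F))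
  | a :: l => QuadraticModuleCat.of
      (QuadraticForm.tmul (QuadraticMap.weightedSumSquares F ![(1 : F), (a : F)]) (pfister l).form)

/-- A quadratic form is a Pfister form if it is isometric to some `⟨⟨a₁, …, aₙ⟩⟩`. -/
def IsPfister [Invertible (2 : F)] {E : Type v} [AddCommGroup E] [Module F E]
    (Q : QuadraticForm F E) : Prop :=
  ∃ l : List Fˣ, Q.Equivalent (pfister l).form

/-- `Q` is a subform of `P`: there is a (regular) quadratic form `R` with `P ≃ Q ⊥ R`. -/
def IsSubform {E : Type v} [AddCommGroup E] [Module F E]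
    {E' : Type w} [AddCommGroup E'] [Module F E']
    (Q : QuadraticForm F E) (P : QuadraticForm F E') : Prop :=
  ∃ (m : ℕ) (R : QuadraticForm F (Fin m → F)), IsRegular R ∧ P.Equivalent (Q.prod R)

/-- `Q` is a Pfister neighbor: `Q` is similar to a subform of a Pfister form `φ`
with `dim φ < 2 dim Q`. -/
def IsPfisterNeighbor [Invertible (2 : F)] {E : Type v} [AddCommGroup E] [Module F E]
    (Q : QuadraticForm F E) : Prop :=
  ∃ (l : List Fˣ) (a : Fˣ), IsSubform ((a : F) • Q) (pfister l).form ∧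
    Module.finrank F (pfister l) < 2 * Module.finrank F E

/-- The determinant of `Q` (the determinant of a Gram matrix, as a class modulo nonzero squares)
is trivial. -/
def HasTrivialDet [Invertible (2 : F)] {E : Type v} [AddCommGroup E] [Module F E]
    (Q : QuadraticForm F E) : Prop :=
  ∃ (b : Module.Basis (Fin (Module.finrank F E)) F E) (c : Fˣ), Q.discr b = (c : F) ^ 2

/-- Scalar multiplication by an element of `F` is uniformly continuous for the `v`-adic uniform
structure, so that the `v`-adic completion of `F` is an `F`-algebra via `F → F_v`. -/
instance uniformContinuousConstSMul_withVal (v : Valuation F (WithZero (Multiplicative ℤ))) :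
    UniformContinuousConstSMul F (WithVal v) := by
  refine ⟨fun c ↦ ?_⟩
  simp_rw [WithVal.smul_right_def, Algebra.smul_def]
  exact (Ring.uniformContinuousConstSMul (WithVal v)).uniformContinuous_const_smul _

/-- The Hasse principle for isotropy with respect to a set `V` of discrete valuations. -/
def HasseIsotropy [Invertible (2 : F)] (V : Set (Valuation F (WithZero (Multiplicative ℤ))))
    {E : Type v} [AddCommGroup E] [Module F E] (Q : QuadraticForm F E) : Prop :=
  (∀ v ∈ V, IsIsotropic (Q.baseChange v.Completion)) → IsIsotropic Q

/-- The Hasse principle for isometry, for a pair of forms, with respect to a set `V` of discrete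
valuations. -/
def HasseIsometry [Invertible (2 : F)] (V : Set (Valuation F (WithZero (Multiplicative ℤ))))
    {E₁ : Type v} [AddCommGroup E₁] [Module F E₁] {E₂ : Type w} [AddCommGroup E₂] [Module F E₂]
    (Q₁ : QuadraticForm F E₁) (Q₂ : QuadraticForm F E₂) : Prop :=
  (∀ v ∈ V, (Q₁.baseChange v.Completion).Equivalent (Q₂.baseChange v.Completion)) →
    Q₁.Equivalent Q₂

end Forms

/-- The set of discrete valuations (with value group infinite cyclic, hence nontrivial) on `k(t)`
that are trivial on `k`. -/
def valuationsTrivialOn (k : Type u) [Field k] :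
    Set (Valuation (RatFunc k) (WithZero (Multiplicative ℤ))) :=
  {v | v.IsRankOneDiscrete ∧ v.IsTrivialOn k}

/-- In characteristic different from `2`, the element `2` of `k(t)` is invertible. -/
instance invertibleTwoRatFunc (k : Type u) [Field k] [NeZero (2 : k)] :
    Invertible (2 : RatFunc k) :=
  invertibleOfNonzero (by
    have h := (map_ne_zero (algebraMap k (RatFunc k))).mpr (NeZero.ne (2 : k))
    rwa [map_ofNat] at h)

end HasseQF

end

/-! Everything rests on one local-global statement: a regular form over `k(X)` that is hyperbolic
over the completion at every prime of `k[X]` is hyperbolic (`isHyp_of_completions`). The place at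
infinity is not needed.

A hyperbolic form contains a unimodular lattice. Unimodularity is an open condition and `K` is dense
in `K_v`, so at each prime the lattice can be chosen over `K`. Since `k[X]` is a principal ideal
domain, these local lattices glue to a unimodular form over `k[X]` (`exists_cong_map_algebraMap`).
By Harder's theorem (`exists_cong_map_C`) that form comes from a constant form over `k`; the engine
is Hermite reduction, which bounds the degree of a minimal value by that of the determinant. At the
place `X = 0` the residue field is `k`, so reducing a primitive zero there shows that isotropy of a
constant form descends to `k`. With Witt cancellation, hyperbolicity descends as well.

For (a), apply this to `q₁ ⊥ -q₂` and cancel. For (b), a locally isotropic neighbor makes its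
Pfister form locally isotropic, hence locally hyperbolic, because Pfister forms are round. The
Pfister form is then globally hyperbolic, and a subform of more than half its dimension meets a
totally isotropic subspace of half dimension. In (c), each form is a Pfister form up to similarity,
or a neighbor of one.

The argument is carried out on Gram matrices up to congruence and transferred to quadratic forms at
the end. -/

set_option linter.unusedSectionVars false

namespace HasseQF

open Matrix

/-! ### Congruence of symmetric matrices and orthogonal splitting over a PID -/

section Cong

variable {R S : Type*} [CommRing R] [CommRing S]
variable {l m n p q : Type*} [Fintype l] [Fintype m] [Fintype n] [Fintype p] [Fintype q]
  [DecidableEq l] [DecidableEq m] [DecidableEq n] [DecidableEq p] [DecidableEq q]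

/-- Congruence of square matrices, possibly with different index types. -/
def Cong (G : Matrix m m R) (H : Matrix n n R) : Prop :=
  ∃ (P : Matrix m n R) (P' : Matrix n m R), P * P' = 1 ∧ P' * P = 1 ∧ Pᵀ * G * P = H

theorem Cong.refl (G : Matrix m m R) : Cong G G := ⟨1, 1, by simp⟩

theorem Cong.symm {G : Matrix m m R} {H : Matrix n n R} (h : Cong G H) : Cong H G := by
  obtain ⟨P, P', h1, h2, rfl⟩ := h
  refine ⟨P', P, h2, h1, ?_⟩
  have h3 : P'ᵀ * Pᵀ = 1 := by rw [← transpose_mul, h1, transpose_one]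
  calc P'ᵀ * (Pᵀ * G * P) * P' = (P'ᵀ * Pᵀ) * G * (P * P') := by simp only [Matrix.mul_assoc]
    _ = G := by rw [h1, h3, Matrix.one_mul, Matrix.mul_one]

theorem Cong.trans {G : Matrix l l R} {H : Matrix m m R} {K : Matrix n n R} (h : Cong G H)
    (h' : Cong H K) : Cong G K := by
  obtain ⟨P, P', h1, h2, rfl⟩ := h
  obtain ⟨Q, Q', h3, h4, rfl⟩ := h'
  refine ⟨P * Q, Q' * P', ?_, ?_, ?_⟩
  · rw [Matrix.mul_assoc, ← Matrix.mul_assoc Q, h3, Matrix.one_mul, h1]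
  · rw [Matrix.mul_assoc, ← Matrix.mul_assoc P', h2, Matrix.one_mul, h4]
  · simp only [transpose_mul, Matrix.mul_assoc]

theorem Cong.map {G : Matrix m m R} {H : Matrix n n R} (h : Cong G H) (f : R →+* S) :
    Cong (G.map f) (H.map f) := by
  obtain ⟨P, P', h1, h2, rfl⟩ := h
  refine ⟨P.map f, P'.map f, ?_, ?_, ?_⟩
  · rw [← Matrix.map_mul, h1, Matrix.map_one _ f.map_zero f.map_one]
  · rw [← Matrix.map_mul, h2, Matrix.map_one _ f.map_zero f.map_one]
  · rw [Matrix.map_mul, Matrix.map_mul, Matrix.transpose_map]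

theorem Cong.smul {G : Matrix m m R} {H : Matrix n n R} (h : Cong G H) (c : R) :
    Cong (c • G) (c • H) := by
  obtain ⟨P, P', h1, h2, rfl⟩ := h
  exact ⟨P, P', h1, h2, by simp⟩

theorem Cong.neg {G : Matrix m m R} {H : Matrix n n R} (h : Cong G H) : Cong (-G) (-H) := by
  obtain ⟨P, P', h1, h2, rfl⟩ := h
  exact ⟨P, P', h1, h2, by simp⟩

theorem Cong.isSymm {G : Matrix m m R} {H : Matrix n n R} (h : Cong G H) (hG : G.IsSymm) :
    H.IsSymm := by
  obtain ⟨P, P', h1, h2, rfl⟩ := h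
  simp only [Matrix.IsSymm, transpose_mul, transpose_transpose, hG.eq, Matrix.mul_assoc]

theorem Cong.isUnit {G : Matrix m m R} {H : Matrix n n R} (h : Cong G H) (hG : IsUnit G) :
    IsUnit H := by
  obtain ⟨P, P', h1, h2, rfl⟩ := h
  obtain ⟨⟨G, G', h3, h4⟩, rfl⟩ := hG
  have h5 : Pᵀ * P'ᵀ = 1 := by rw [← transpose_mul, h2, transpose_one]
  have : (Pᵀ * G * P) * (P' * G' * P'ᵀ) = 1 := by
    calc (Pᵀ * G * P) * (P' * G' * P'ᵀ) = Pᵀ * (G * ((P * P') * G')) * P'ᵀ := by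
          simp only [Matrix.mul_assoc]
      _ = 1 := by rw [h1, Matrix.one_mul, h3, Matrix.mul_one, h5]
  exact ⟨⟨_, _, this, mul_eq_one_comm.mp this⟩, rfl⟩

theorem Cong.card_eq [Nontrivial R] {G : Matrix m m R} {H : Matrix n n R} (h : Cong G H) :
    Fintype.card m = Fintype.card n := by
  obtain ⟨P, P', h1, h2, -⟩ := h
  have e : (n → R) ≃ₗ[R] (m → R) := Matrix.toLin'OfInv h2 h1
  exact (card_eq_of_linearEquiv R e).symm

theorem cong_submatrix (G : Matrix m m R) (e : n ≃ m) : Cong G (G.submatrix e e) := by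
  refine ⟨(1 : Matrix m m R).submatrix id e, (1 : Matrix m m R).submatrix e id, ?_, ?_, ?_⟩
  · rw [submatrix_mul_equiv]; simp
  · rw [← submatrix_mul _ _ _ _ _ Function.bijective_id]; simp
  · ext i j
    simp [Matrix.mul_apply, Matrix.one_apply]

/-- Orthogonal sum of square matrices. -/
abbrev dsum (A : Matrix m m R) (B : Matrix n n R) : Matrix (m ⊕ n) (m ⊕ n) R :=
  fromBlocks A 0 0 B

theorem Cong.add {A : Matrix l l R} {A' : Matrix m m R} {B : Matrix n n R} {B' : Matrix p p R}
    (h : Cong A A') (h' : Cong B B') : Cong (dsum A B) (dsum A' B') := by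
  obtain ⟨P, P', h1, h2, rfl⟩ := h
  obtain ⟨Q, Q', h3, h4, rfl⟩ := h'
  refine ⟨fromBlocks P 0 0 Q, fromBlocks P' 0 0 Q', ?_, ?_, ?_⟩ <;>
    simp [fromBlocks_transpose, fromBlocks_multiply, *]

theorem cong_dsum_comm (A : Matrix m m R) (B : Matrix n n R) : Cong (dsum A B) (dsum B A) := by
  have := cong_submatrix (dsum A B) (Equiv.sumComm n m)
  rwa [show (fromBlocks A 0 0 B).submatrix _ _ = fromBlocks B 0 0 A from by
    ext (i | i) (j | j) <;> simp] at this

theorem cong_dsum_assoc (A : Matrix m m R) (B : Matrix n n R) (C : Matrix p p R) :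
    Cong (dsum (dsum A B) C) (dsum A (dsum B C)) := by
  have := cong_submatrix (dsum (dsum A B) C) (Equiv.sumAssoc m n p).symm
  rwa [show (fromBlocks (fromBlocks A 0 0 B) 0 0 C).submatrix _ _ =
    fromBlocks A 0 0 (fromBlocks B 0 0 C) from by
    ext (i | i | i) (j | j | j) <;> simp] at this

theorem cong_dsum_dsum_comm (A : Matrix m m R) (B : Matrix n n R) (C : Matrix p p R)
    (D : Matrix q q R) :
    Cong (dsum (dsum A B) (dsum C D)) (dsum (dsum A C) (dsum B D)) := by
  have := cong_submatrix (dsum (dsum A B) (dsum C D)) (Equiv.sumSumSumComm m p n q)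
  rwa [show (fromBlocks (fromBlocks A 0 0 B) 0 0 (fromBlocks C 0 0 D)).submatrix _ _ =
    fromBlocks (fromBlocks A 0 0 C) 0 0 (fromBlocks B 0 0 D) from by
    ext ((i | i) | (i | i)) ((j | j) | (j | j)) <;> simp] at this

theorem cong_dsum_empty [IsEmpty n] (A : Matrix m m R) (B : Matrix n n R) : Cong A (dsum A B) := by
  have := cong_submatrix A (Equiv.sumEmpty m n)
  rwa [show A.submatrix (Equiv.sumEmpty m n) (Equiv.sumEmpty m n) = fromBlocks A 0 0 B from by
    ext (i | i) (j | j) <;> first | exact isEmptyElim i | exact isEmptyElim j | simp] at this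

theorem cong_diagonal_of_eq_mul_sq (w w' u : m → R) (hu : ∀ i, IsUnit (u i))
    (h : ∀ i, w' i = w i * u i ^ 2) : Cong (diagonal w) (diagonal w') := by
  choose u hu using hu
  obtain rfl := funext hu
  refine ⟨diagonal fun i ↦ (u i : R), diagonal fun i ↦ ((u i)⁻¹ : Rˣ), ?_, ?_, ?_⟩
  · simp
  · simp
  · simp only [diagonal_transpose, diagonal_mul_diagonal]
    congr 1; ext i; rw [h]; ring

theorem dsum_diagonal (a : m → R) (b : n → R) :
    dsum (diagonal a) (diagonal b) = diagonal (Sum.elim a b) := fromBlocks_diagonal a b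

theorem isUnit_dsum_iff (A : Matrix m m R) (B : Matrix n n R) :
    IsUnit (dsum A B) ↔ IsUnit A ∧ IsUnit B := by
  simp only [isUnit_iff_isUnit_det, det_fromBlocks_zero₂₁, IsUnit.mul_iff]

theorem isSymm_dsum_iff (A : Matrix m m R) (B : Matrix n n R) :
    (dsum A B).IsSymm ↔ A.IsSymm ∧ B.IsSymm := by
  simp [isSymm_fromBlocks_iff]

theorem map_dsum (A : Matrix m m R) (B : Matrix n n R) (f : R →+* S) :
    (dsum A B).map f = dsum (A.map f) (B.map f) := by
  simp [fromBlocks_map]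

/-- A square matrix is isotropic if its quadratic form has a nontrivial zero. -/
def Isotropic (G : Matrix m m R) : Prop := ∃ x : m → R, x ≠ 0 ∧ x ⬝ᵥ G *ᵥ x = 0

theorem dotProduct_cong_mulVec (G : Matrix m m R) (P : Matrix m n R) (x y : n → R) :
    x ⬝ᵥ (Pᵀ * G * P) *ᵥ y = (P *ᵥ x) ⬝ᵥ G *ᵥ (P *ᵥ y) := by
  rw [← mulVec_mulVec, ← mulVec_mulVec, dotProduct_mulVec, vecMul_transpose]

theorem transpose_mul_mul_apply (G : Matrix m m R) (P : Matrix m n R) (i j : n) :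
    (Pᵀ * G * P) i j = P.col i ⬝ᵥ G *ᵥ P.col j := by
  rw [Matrix.mul_assoc]
  rfl

theorem Cong.isotropic {G : Matrix m m R} {H : Matrix n n R} (h : Cong G H) (hH : Isotropic H) :
    Isotropic G := by
  obtain ⟨P, P', h1, h2, rfl⟩ := h
  obtain ⟨x, hx, h0⟩ := hH
  refine ⟨P *ᵥ x, fun h ↦ hx ?_, by rwa [dotProduct_cong_mulVec] at h0⟩
  rw [← one_mulVec x, ← h2, ← mulVec_mulVec, h, mulVec_zero]

theorem Isotropic.dsum_left {A : Matrix m m R} (h : Isotropic A) (B : Matrix n n R) :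
    Isotropic (dsum A B) := by
  obtain ⟨x, hx, h0⟩ := h
  refine ⟨Sum.elim x 0, fun h ↦ hx (funext fun i ↦ congrFun h (.inl i)), ?_⟩
  simp [fromBlocks_mulVec, h0]

theorem Isotropic.smul {A : Matrix m m R} (h : Isotropic A) (c : R) : Isotropic (c • A) := by
  obtain ⟨x, hx, h0⟩ := h
  exact ⟨x, hx, by simp [smul_mulVec, h0]⟩

theorem mul_left_cancel_of_mulVec {Y : Matrix m n R} (hY : ∀ x, Y *ᵥ x = 0 → x = 0)
    {A B : Matrix n p R} (h : Y * A = Y * B) : A = B := by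
  ext i j
  have := hY (A.col j - B.col j) (by
    ext i
    have := congrFun (congrFun h i) j
    simp only [mulVec_sub, Pi.sub_apply, Pi.zero_apply, sub_eq_zero]
    simpa [Matrix.mul_apply, mulVec, dotProduct] using this)
  exact sub_eq_zero.mp (congrFun this i)

/-- Over a principal ideal domain, a left invertible matrix can be completed to an invertible
one. -/
theorem exists_fromCols_isUnit [IsDomain R] [IsPrincipalIdealRing R] {M : Matrix p n R}
    {Z : Matrix n p R} (h : M * Z = 1) :
    ∃ (m : ℕ) (Y : Matrix n (Fin m) R) (C : Matrix (Fin m) n R), M * Y = 0 ∧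
      fromCols Z Y * fromRows M C = 1 ∧ fromRows M C * fromCols Z Y = 1 := by
  -- Since `M * Z = 1`, the whole module is the image of `Z` plus `ker M`, a direct sum. The kernel
  -- is free over a principal ideal domain, and its basis supplies the columns of `Y`.
  obtain ⟨m, b⟩ := Submodule.basisOfPid (Pi.basisFun R n) (LinearMap.ker M.mulVecLin)
  let Y : Matrix n (Fin m) R := of fun i j ↦ (b j : n → R) i
  have hYv (x : Fin m → R) : Y *ᵥ x = ((∑ j, x j • b j : LinearMap.ker M.mulVecLin) : n → R) := by
    ext i
    simp [Y, mulVec, dotProduct, mul_comm]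
  have hMY : M * Y = 0 := by
    ext i j
    exact congrFun (LinearMap.mem_ker.mp (b j).2) i
  have hYinj (x : Fin m → R) (h : Y *ᵥ x = 0) : x = 0 := by
    rw [hYv] at h
    have h := Submodule.coe_eq_zero.mp h
    exact funext (Fintype.linearIndependent_iff.mp b.linearIndependent x h)
  have hker (x : n → R) : (1 - Z * M) *ᵥ x ∈ LinearMap.ker M.mulVecLin := by
    rw [LinearMap.mem_ker, mulVecLin_apply, mulVec_mulVec, Matrix.mul_sub, Matrix.mul_one,
      ← Matrix.mul_assoc, h, Matrix.one_mul, sub_self, zero_mulVec]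
  -- The coordinates, in the basis of the kernel, of the projection `1 - Z * M`.
  let C : Matrix (Fin m) n R := of fun i j ↦ b.repr ⟨_, hker (Pi.single j 1)⟩ i
  have hC : Y * C = 1 - Z * M := by
    ext i j
    have h3 := congrFun (hYv (C.col j)) i
    have h4 : ∑ l, C.col j l • b l = ⟨_, hker (Pi.single j 1)⟩ :=
      b.sum_repr ⟨_, hker (Pi.single j 1)⟩
    rw [h4] at h3
    simp only [mulVec_single_one] at h3
    exact h3
  refine ⟨m, Y, C, hMY, ?_, ?_⟩
  · rw [fromCols_mul_fromRows, hC]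
    simp
  · have h3 : C * Z = 0 := mul_left_cancel_of_mulVec hYinj (by
      rw [← Matrix.mul_assoc, hC, Matrix.sub_mul, Matrix.one_mul, Matrix.mul_assoc, h,
        Matrix.mul_one, sub_self, Matrix.mul_zero])
    have h4 : C * Y = 1 := mul_left_cancel_of_mulVec hYinj (by
      rw [← Matrix.mul_assoc, hC, Matrix.sub_mul, Matrix.one_mul, Matrix.mul_assoc, hMY,
        Matrix.mul_zero, sub_zero, Matrix.mul_one])
    rw [fromRows_mul_fromCols, h, hMY, h3, h4, fromBlocks_one]

/-- Over a principal ideal domain, a regular subform splits off as an orthogonal summand. -/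
theorem exists_cong_dsum [IsDomain R] [IsPrincipalIdealRing R] {G : Matrix n n R} (hG : G.IsSymm)
    (Z : Matrix n p R) {H : Matrix p p R} (hZ : Zᵀ * G * Z = H) (hH : IsUnit H) :
    ∃ (m : ℕ) (G' : Matrix (Fin m) (Fin m) R), Cong G (dsum H G') := by
  obtain ⟨⟨H, H', h1, h2⟩, rfl⟩ := hH
  simp only at hZ
  -- `H⁻¹ Zᵀ G` is a left inverse of `Z` whose kernel is the orthogonal complement of the columns of
  -- `Z`.
  obtain ⟨m, Y, C, hMY, h3, h4⟩ := exists_fromCols_isUnit (M := H' * (Zᵀ * G)) (Z := Z)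
    (by rw [Matrix.mul_assoc, hZ, h2])
  have hZY : Zᵀ * G * Y = 0 := by
    rw [← Matrix.one_mul (Zᵀ * G), ← h1, Matrix.mul_assoc H, Matrix.mul_assoc H, hMY,
      Matrix.mul_zero]
  have hYZ : Yᵀ * G * Z = 0 := by
    rw [← transpose_inj, transpose_zero, ← hZY]
    simp [hG.eq, Matrix.mul_assoc]
  refine ⟨m, Yᵀ * G * Y, fromCols Z Y, fromRows (H' * (Zᵀ * G)) C, h3, h4, ?_⟩
  rw [transpose_fromCols, fromRows_mul, fromRows_mul_fromCols, hZ, hZY, hYZ]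

/-- The transition matrix need not have equal index types, so it is made square along a bijection
before taking its determinant. -/
theorem Cong.exists_det {G : Matrix m m R} {H : Matrix n n R} [Nontrivial R] (h : Cong G H) :
    ∃ u : Rˣ, H.det = u ^ 2 * G.det := by
  have e : n ≃ m := Fintype.equivOfCardEq h.card_eq.symm
  obtain ⟨P, P', h1, h2, rfl⟩ := h
  have hu : P.submatrix id e.symm * P'.submatrix e.symm id = 1 := by
    rw [submatrix_mul_equiv, h1, submatrix_id_id]
  have hu' : IsUnit (P.submatrix id e.symm).det := by
    rw [← isUnit_iff_isUnit_det]
    exact ⟨⟨_, _, hu, mul_eq_one_comm.mp hu⟩, rfl⟩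
  refine ⟨hu'.unit, ?_⟩
  have h3 : (Pᵀ * G * P).submatrix e.symm e.symm =
      (P.submatrix id e.symm)ᵀ * G * P.submatrix id e.symm := by
    ext i j
    simp [Matrix.mul_apply]
  rw [← det_submatrix_equiv_self e.symm, h3, det_mul, det_mul, det_transpose, IsUnit.unit_spec]
  ring

end Cong

end HasseQF

namespace HasseQF

open Matrix

/-! ### Reflections and Witt cancellation -/

section Witt

variable {F : Type*} [Field F]
variable {m n p : Type*} [Fintype m] [Fintype n] [Fintype p]
  [DecidableEq m] [DecidableEq n] [DecidableEq p]

theorem dotProduct_mulVec_comm {R : Type*} [CommRing R] {G : Matrix n n R} (hG : G.IsSymm)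
    (x y : n → R) : x ⬝ᵥ G *ᵥ y = y ⬝ᵥ G *ᵥ x := by
  rw [dotProduct_mulVec, ← mulVec_transpose, hG.eq, dotProduct_comm]

/-- The reflection in an anisotropic vector is an isometric involution. -/
theorem reflection_isometry {G : Matrix n n F} (hG : G.IsSymm) {w : n → F} {c : F}
    (hc : c * (w ⬝ᵥ G *ᵥ w) = 2) :
    (1 - c • vecMulVec w (G *ᵥ w)) * (1 - c • vecMulVec w (G *ᵥ w)) = 1 ∧
      (1 - c • vecMulVec w (G *ᵥ w))ᵀ * G * (1 - c • vecMulVec w (G *ᵥ w)) = G := by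
  have hT : (vecMulVec w (G *ᵥ w))ᵀ * G = G * vecMulVec w (G *ᵥ w) := by
    rw [transpose_vecMulVec, mul_vecMulVec, vecMulVec_mul, ← mulVec_transpose, hG.eq]
  have hR : (1 - c • vecMulVec w (G *ᵥ w)) * (1 - c • vecMulVec w (G *ᵥ w)) = 1 := by
    have hV : vecMulVec w (G *ᵥ w) * vecMulVec w (G *ᵥ w) =
        (w ⬝ᵥ G *ᵥ w) • vecMulVec w (G *ᵥ w) := by
      rw [vecMulVec_mul_vecMulVec, dotProduct_comm, vecMulVec_smul]
    rw [Matrix.sub_mul, Matrix.one_mul, Matrix.smul_mul, Matrix.mul_sub, Matrix.mul_one,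
      Matrix.mul_smul, hV, smul_smul c (w ⬝ᵥ G *ᵥ w), hc]
    module
  refine ⟨hR, ?_⟩
  have : (1 - c • vecMulVec w (G *ᵥ w))ᵀ * G = G * (1 - c • vecMulVec w (G *ᵥ w)) := by
    rw [transpose_sub, transpose_smul, Matrix.sub_mul, Matrix.smul_mul, hT, Matrix.mul_sub,
      Matrix.mul_smul, transpose_one, Matrix.one_mul, Matrix.mul_one]
  rw [this, Matrix.mul_assoc, hR, Matrix.mul_one]

/-- Isometries act transitively on the vectors representing a given nonzero value. -/
theorem exists_isometry_mulVec_eq (h2 : (2 : F) ≠ 0) {G : Matrix n n F} (hG : G.IsSymm)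
    {x y : n → F} (hxy : x ⬝ᵥ G *ᵥ x = y ⬝ᵥ G *ᵥ y) (hx : x ⬝ᵥ G *ᵥ x ≠ 0) :
    ∃ R : Matrix n n F, R * R = 1 ∧ Rᵀ * G * R = G ∧ R *ᵥ x = y := by
  have hmv (w : n → F) (c : F) : (1 - c • vecMulVec w (G *ᵥ w)) *ᵥ x =
      x - (c * (w ⬝ᵥ G *ᵥ x)) • w := by
    rw [sub_mulVec, one_mulVec, smul_mulVec, vecMulVec_mulVec, dotProduct_comm,
      dotProduct_mulVec_comm hG]
    ext i; simp; ring
  -- The values at `x - y` and `x + y` add up to four times the value at `x`, so they do not both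
  -- vanish. The reflection in `x - y` sends `x` to `y`; failing that, minus the reflection in `x +
  -- y` does.
  by_cases h : (x - y) ⬝ᵥ G *ᵥ (x - y) = 0
  · have h' : (x + y) ⬝ᵥ G *ᵥ (x + y) = 4 * (x ⬝ᵥ G *ᵥ x) := by
      simp only [mulVec_sub, dotProduct_sub, sub_dotProduct, mulVec_add, dotProduct_add,
        add_dotProduct] at h ⊢
      linear_combination -h - 2 * hxy
    have h4 : (4 : F) * (x ⬝ᵥ G *ᵥ x) ≠ 0 :=
      mul_ne_zero (by rw [show (4 : F) = 2 * 2 by norm_num]; exact mul_ne_zero h2 h2) hx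
    obtain ⟨h5, h6⟩ := reflection_isometry hG (w := x + y)
      (c := 2 / ((x + y) ⬝ᵥ G *ᵥ (x + y))) (div_mul_cancel₀ _ (h' ▸ h4))
    refine ⟨-(1 - (2 / ((x + y) ⬝ᵥ G *ᵥ (x + y))) • vecMulVec (x + y) (G *ᵥ (x + y))), ?_, ?_, ?_⟩
    · rw [Matrix.neg_mul, Matrix.mul_neg, neg_neg, h5]
    · rw [transpose_neg, Matrix.neg_mul, Matrix.neg_mul, Matrix.mul_neg, neg_neg, h6]
    · have h7 : (x + y) ⬝ᵥ G *ᵥ x = 2 * (x ⬝ᵥ G *ᵥ x) := by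
        simp only [mulVec_sub, dotProduct_sub, sub_dotProduct, add_dotProduct] at h ⊢
        have := dotProduct_mulVec_comm hG x y
        have h8 : (2 : F) * (y ⬝ᵥ G *ᵥ x) = 2 * (x ⬝ᵥ G *ᵥ x) := by
          linear_combination -h - hxy - this
        rw [mul_left_cancel₀ h2 h8]; ring
      rw [neg_mulVec, hmv, h', h7, show 2 / (4 * (x ⬝ᵥ G *ᵥ x)) * (2 * (x ⬝ᵥ G *ᵥ x)) = 1 by
        rw [div_mul_eq_mul_div, div_eq_one_iff_eq h4]; ring]
      simp
  · obtain ⟨h5, h6⟩ := reflection_isometry hG (w := x - y)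
      (c := 2 / ((x - y) ⬝ᵥ G *ᵥ (x - y))) (div_mul_cancel₀ _ h)
    refine ⟨_, h5, h6, ?_⟩
    have h7 : (x - y) ⬝ᵥ G *ᵥ (x - y) = 2 * ((x - y) ⬝ᵥ G *ᵥ x) := by
      have := dotProduct_mulVec_comm hG x y
      simp only [mulVec_sub, dotProduct_sub, sub_dotProduct]
      linear_combination -hxy - this
    rw [hmv, div_mul_eq_mul_div, ← h7, div_self h]
    simp

/-- Witt cancellation of a one-dimensional form. -/
theorem Cong.cancel_unit (h2 : (2 : F) ≠ 0) {a : F} (ha : a ≠ 0) {A : Matrix m m F}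
    {B : Matrix n n F} (hA : A.IsSymm)
    (h : Cong (dsum (diagonal fun _ : Unit ↦ a) A) (dsum (diagonal fun _ : Unit ↦ a) B)) :
    Cong A B := by
  obtain ⟨P, P', hP, hP', hG⟩ := h
  have hval {k : Type _} [Fintype k] [DecidableEq k] (C : Matrix k k F) :
      (Pi.single (Sum.inl ()) 1 : Unit ⊕ k → F) ⬝ᵥ
        dsum (diagonal fun _ : Unit ↦ a) C *ᵥ Pi.single (Sum.inl ()) 1 = a := by
    simp
  have hu : (P *ᵥ Pi.single (Sum.inl ()) 1) ⬝ᵥ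
      dsum (diagonal fun _ : Unit ↦ a) A *ᵥ (P *ᵥ Pi.single (Sum.inl ()) 1) = a := by
    rw [← dotProduct_cong_mulVec, hG]
    simp
  -- Correct the isometry `P` by `R` so that `R * P` fixes the basis vector of the summand `⟨a⟩`.
  -- Both `R * P` and its inverse are then block upper triangular.
  obtain ⟨R, hRR, hR, hRu⟩ := exists_isometry_mulVec_eq h2
    ((isSymm_dsum_iff _ _).mpr ⟨diagonal_transpose _, hA⟩) (hu.trans (hval A).symm) (by rwa [hu])
  have hQ1 : (R * P) * (P' * R) = 1 := by
    rw [Matrix.mul_assoc, ← Matrix.mul_assoc P, hP, Matrix.one_mul, hRR]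
  have hQ2 : (P' * R) * (R * P) = 1 := by
    rw [Matrix.mul_assoc, ← Matrix.mul_assoc R, hRR, Matrix.one_mul, hP']
  have hQG : (R * P)ᵀ * dsum (diagonal fun _ : Unit ↦ a) A * (R * P) =
      dsum (diagonal fun _ : Unit ↦ a) B := by
    rw [← hG, transpose_mul]
    calc _ = Pᵀ * (Rᵀ * dsum (diagonal fun _ : Unit ↦ a) A * R) * P := by
          simp only [Matrix.mul_assoc]
      _ = _ := by rw [hR]
  have hQe : (R * P) *ᵥ Pi.single (Sum.inl ()) 1 = Pi.single (Sum.inl ()) 1 := by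
    rw [← mulVec_mulVec, hRu]
  have hQe' : (P' * R) *ᵥ Pi.single (Sum.inl ()) 1 = Pi.single (Sum.inl ()) 1 := by
    nth_rewrite 1 [← hQe]
    rw [mulVec_mulVec, hQ2, one_mulVec]
  generalize R * P = Q at *
  generalize P' * R = Q' at *
  have hQ : Q = fromBlocks 1 Q.toBlocks₁₂ 0 Q.toBlocks₂₂ := by
    ext (i | i) (j | j)
    · simpa [one_apply] using congrFun hQe (Sum.inl i)
    · rfl
    · simpa using congrFun hQe (Sum.inr i)
    · rfl
  have hQ' : Q' = fromBlocks 1 Q'.toBlocks₁₂ 0 Q'.toBlocks₂₂ := by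
    ext (i | i) (j | j)
    · simpa [one_apply] using congrFun hQe' (Sum.inl i)
    · rfl
    · simpa using congrFun hQe' (Sum.inr i)
    · rfl
  rw [hQ, hQ', fromBlocks_multiply, ← fromBlocks_one, fromBlocks_inj] at hQ1
  rw [hQ, hQ', fromBlocks_multiply, ← fromBlocks_one, fromBlocks_inj] at hQ2
  rw [hQ, fromBlocks_transpose, fromBlocks_multiply, fromBlocks_multiply, fromBlocks_inj] at hQG
  -- The upper right block of the transformed form is `a` times this block and must be zero.
  have hr : Q.toBlocks₁₂ = 0 := by
    ext i j
    have := congrFun (congrFun hQG.2.1 i) j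
    simpa [ha] using this
  refine ⟨Q.toBlocks₂₂, Q'.toBlocks₂₂, by simpa using hQ1.2.2.2, by simpa using hQ2.2.2.2, ?_⟩
  simpa [hr] using hQG.2.2.2

theorem cong_diagonal_comp {R : Type*} [CommRing R] (w : m → R) (e : n ≃ m) :
    Cong (diagonal w) (diagonal (w ∘ e)) := by
  have := cong_submatrix (diagonal w) e
  rwa [submatrix_diagonal_equiv] at this

/-- Witt cancellation of a regular diagonal form. -/
theorem Cong.cancel_diagonal (h2 : (2 : F) ≠ 0) {w : p → F} (hw : ∀ i, w i ≠ 0) {A : Matrix m m F}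
    {B : Matrix n n F} (hA : A.IsSymm)
    (h : Cong (dsum (diagonal w) A) (dsum (diagonal w) B)) : Cong A B := by
  have key (k : ℕ) (w : Fin k → F) (hw : ∀ i, w i ≠ 0)
      (h : Cong (dsum (diagonal w) A) (dsum (diagonal w) B)) : Cong A B := by
    induction k with
    | zero =>
      exact (cong_dsum_empty A (diagonal w)).trans ((cong_dsum_comm _ _).trans
        (h.trans ((cong_dsum_comm _ _).trans (cong_dsum_empty B (diagonal w)).symm)))
    | succ k ih =>
      have e : Cong (diagonal w)
          (dsum (diagonal fun _ : Unit ↦ w 0) (diagonal fun i : Fin k ↦ w i.succ)) := by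
        rw [dsum_diagonal]
        convert! cong_diagonal_comp w
          (((Equiv.optionEquivSumPUnit (Fin k)).symm.trans (finSuccEquiv k).symm).symm.trans
            (Equiv.sumComm _ _)).symm using 2
        funext i
        rcases i with i | i <;> simp
      have h1 {k' : Type _} [Fintype k'] [DecidableEq k'] (C : Matrix k' k' F) :
        Cong (dsum (diagonal w) C) (dsum (diagonal fun _ : Unit ↦ w 0)
          (dsum (diagonal fun i : Fin k ↦ w i.succ) C)) :=
        (e.add (Cong.refl C)).trans (cong_dsum_assoc _ _ _)
      refine ih (fun i ↦ w i.succ) (fun i ↦ hw _) (Cong.cancel_unit h2 (hw 0) ?_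
        ((h1 A).symm.trans (h.trans ((e.add (Cong.refl B)).trans (cong_dsum_assoc _ _ _)))))
      exact (isSymm_dsum_iff _ _).mpr ⟨diagonal_transpose _, hA⟩
  have e := cong_diagonal_comp w (Fintype.equivFin p).symm
  exact key _ _ (fun i ↦ hw _)
    ((e.symm.add (Cong.refl A)).trans (h.trans (e.add (Cong.refl B))))

end Witt

/-! ### Hyperbolic forms over rings in which 2 is invertible -/

section Hyperbolic

variable {R : Type*} [CommRing R]
variable {m n p : Type*} [Fintype m] [Fintype n] [Fintype p]
  [DecidableEq m] [DecidableEq n] [DecidableEq p]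

/-- The hyperbolic form of dimension `2 * n`, in diagonal shape. -/
abbrev hyp (R : Type*) [CommRing R] (n : ℕ) : Matrix (Fin n ⊕ Fin n) (Fin n ⊕ Fin n) R :=
  dsum 1 (-1)

/-- A symmetric matrix is hyperbolic if it is congruent to an orthogonal sum of copies of
`⟨1, -1⟩`. -/
def IsHyp (G : Matrix m m R) : Prop := ∃ n, Cong G (hyp R n)

theorem isHyp_one_neg_one : IsHyp (dsum (1 : Matrix m m R) (-1 : Matrix m m R)) := by
  refine ⟨Fintype.card m, ?_⟩
  have := cong_submatrix (1 : Matrix m m R) (Fintype.equivFin m).symm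
  rw [submatrix_one_equiv] at this
  exact this.add this.neg

theorem IsHyp.congr {G : Matrix m m R} {H : Matrix n n R} (h : IsHyp H) (e : Cong G H) : IsHyp G :=
  h.imp fun _ h ↦ e.trans h

theorem neg_dsum (A : Matrix m m R) (B : Matrix n n R) : -dsum A B = dsum (-A) (-B) := by
  simp [fromBlocks_neg]

theorem smul_dsum (c : R) (A : Matrix m m R) (B : Matrix n n R) :
    c • dsum A B = dsum (c • A) (c • B) := by
  simp [fromBlocks_smul]

theorem map_hyp {S : Type*} [CommRing S] (f : R →+* S) (n : ℕ) : (hyp R n).map f = hyp S n := by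
  rw [map_dsum, Matrix.map_one _ f.map_zero f.map_one, Matrix.map_neg _ (map_neg f),
    Matrix.map_one _ f.map_zero f.map_one]

theorem isUnit_hyp (n : ℕ) : IsUnit (hyp R n) := (isUnit_dsum_iff _ _).mpr ⟨isUnit_one, isUnit_one.neg⟩

theorem IsHyp.map {G : Matrix m m R} (h : IsHyp G) {S : Type*} [CommRing S] (f : R →+* S) :
    IsHyp (G.map f) := by
  obtain ⟨n, h⟩ := h
  exact ⟨n, map_hyp f n ▸ h.map f⟩

theorem IsHyp.add {G : Matrix m m R} {H : Matrix n n R} (hG : IsHyp G) (hH : IsHyp H) :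
    IsHyp (dsum G H) := by
  obtain ⟨a, ha⟩ := hG
  obtain ⟨b, hb⟩ := hH
  have h1 := (ha.add hb).trans (cong_dsum_dsum_comm _ _ _ _)
  rw [show dsum (-1 : Matrix (Fin a) (Fin a) R) (-1 : Matrix (Fin b) (Fin b) R) = -1 by
    rw [← neg_dsum, dsum, fromBlocks_one],
    show dsum (1 : Matrix (Fin a) (Fin a) R) (1 : Matrix (Fin b) (Fin b) R) = 1 from
      fromBlocks_one] at h1
  exact isHyp_one_neg_one.congr h1

/-- The form `N ⊥ -N` takes the value `(x - y)ᵀ N (x + y)` at `(x, y)`. Substituting `x + y = u + w`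
and `x - y = N⁻¹ (u - w)` turns it into `uᵀ u - wᵀ w`. No diagonalization is needed. -/
theorem cong_dsum_neg [Invertible (2 : R)] {N : Matrix m m R} (hN : N.IsSymm) (hu : IsUnit N) :
    Cong (dsum N (-N)) (dsum (1 : Matrix m m R) (-1 : Matrix m m R)) := by
  obtain ⟨⟨N, N', h1, h2⟩, rfl⟩ := hu
  simp only at hN ⊢
  have hN' : N'ᵀ = N' := by
    have h3 : N * N'ᵀ = 1 := by
      have := congrArg transpose h2
      rwa [transpose_mul, hN.eq, transpose_one] at this
    calc N'ᵀ = (N' * N) * N'ᵀ := by rw [h2, Matrix.one_mul]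
      _ = N' := by rw [Matrix.mul_assoc, h3, Matrix.mul_one]
  have h4 : (⅟2 : R) * ⅟2 * 4 = 1 := by
    have := invOf_mul_self (2 : R)
    linear_combination (2 * ⅟(2:R) + 1) * this
  have key (X : Matrix m m R) : (⅟2 * ⅟2 : R) • ((4 : R) • X) = X := by
    rw [smul_smul, h4, one_smul]
  refine ⟨(⅟2 : R) • fromBlocks (1 + N') (1 - N') (1 - N') (1 + N'),
    (⅟2 : R) • fromBlocks (1 + N) (1 - N) (1 - N) (1 + N), ?_, ?_, ?_⟩
  · rw [Matrix.smul_mul, Matrix.mul_smul, smul_smul, fromBlocks_multiply, ← fromBlocks_one,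
      fromBlocks_smul]
    simp only [Matrix.add_mul, Matrix.sub_mul, Matrix.mul_add, Matrix.mul_sub, h2, Matrix.mul_one,
      Matrix.one_mul]
    congr 1 <;> first
      | exact Eq.trans (congrArg _ (by module)) (key 1)
      | exact Eq.trans (congrArg _ (by module)) (smul_zero _)
  · rw [Matrix.smul_mul, Matrix.mul_smul, smul_smul, fromBlocks_multiply, ← fromBlocks_one,
      fromBlocks_smul]
    simp only [Matrix.add_mul, Matrix.sub_mul, Matrix.mul_add, Matrix.mul_sub, h1, Matrix.mul_one,
      Matrix.one_mul]
    congr 1 <;> first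
      | exact Eq.trans (congrArg _ (by module)) (key 1)
      | exact Eq.trans (congrArg _ (by module)) (smul_zero _)
  · rw [transpose_smul, Matrix.smul_mul, Matrix.mul_smul, Matrix.smul_mul, smul_smul,
      fromBlocks_transpose, fromBlocks_multiply, fromBlocks_multiply, fromBlocks_smul]
    simp only [transpose_add, transpose_sub, transpose_one, hN', Matrix.add_mul, Matrix.sub_mul,
      Matrix.mul_add, Matrix.mul_sub, h1, h2, Matrix.mul_one, Matrix.one_mul, Matrix.mul_neg,
      Matrix.mul_zero, add_zero, zero_add, Matrix.neg_mul]
    congr 1 <;> first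
      | exact Eq.trans (congrArg _ (by module)) (key 1)
      | exact Eq.trans (congrArg _ (by module)) (key (-1))
      | exact Eq.trans (congrArg _ (by module)) (smul_zero _)

theorem isHyp_dsum_neg [Invertible (2 : R)] {N : Matrix m m R} (hN : N.IsSymm) (hu : IsUnit N) :
    IsHyp (dsum N (-N)) :=
  isHyp_one_neg_one.congr (cong_dsum_neg hN hu)

theorem IsHyp.smul [Invertible (2 : R)] {G : Matrix m m R} (h : IsHyp G) {c : R} (hc : IsUnit c) :
    IsHyp (c • G) := by
  obtain ⟨n, h⟩ := h
  refine IsHyp.congr ?_ (h.smul c)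
  rw [smul_dsum, smul_neg]
  refine isHyp_dsum_neg (isSymm_one.smul c) ?_
  rw [isUnit_iff_isUnit_det, det_smul, det_one, mul_one]
  exact hc.pow _

/-- A regular form with a unimodular isotropic vector splits off a hyperbolic plane. -/
theorem exists_cong_dsum_hyp [IsDomain R] [IsPrincipalIdealRing R] [Invertible (2 : R)]
    {G : Matrix m m R} (hG : G.IsSymm) (hu : IsUnit G) {x f : m → R} (hfx : f ⬝ᵥ x = 1)
    (hx : x ⬝ᵥ G *ᵥ x = 0) :
    ∃ (n : ℕ) (G' : Matrix (Fin n) (Fin n) R), Cong G (dsum (hyp R 1) G') := by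
  obtain ⟨⟨G, G', h1, h2⟩, rfl⟩ := hu
  simp only at hG hx ⊢
  -- Unimodularity of `x` and invertibility of `G` provide a vector pairing to 1 with `x`.
  obtain ⟨y, hy⟩ : ∃ y, x ⬝ᵥ G *ᵥ y = 1 :=
    ⟨G' *ᵥ f, by rw [mulVec_mulVec, h1, one_mulVec, dotProduct_comm, hfx]⟩
  have hy' : y ⬝ᵥ G *ᵥ x = 1 := by rw [dotProduct_mulVec_comm hG, hy]
  have hv (s t : R) : (y + s • x) ⬝ᵥ G *ᵥ (y + t • x) = y ⬝ᵥ G *ᵥ y + s + t := by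
    simp only [mulVec_add, mulVec_smul, dotProduct_add, add_dotProduct, smul_dotProduct,
      dotProduct_smul, hx, hy, hy', smul_eq_mul]
    ring
  set q := y ⬝ᵥ G *ᵥ y
  -- The value at `y + s x` is `q + 2 s`. The two coefficients are chosen to give the values `1` and
  -- `-1`, and the two vectors are then orthogonal.
  let Z : Matrix m (Fin 1 ⊕ Fin 1) R := fromCols (replicateCol _ (y + (⅟2 * (1 - q)) • x))
    (replicateCol _ (y + (⅟2 * (-1 - q)) • x))
  refine exists_cong_dsum hG Z ?_ (isUnit_hyp 1)
  have h3 := invOf_mul_self (2 : R)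
  ext (i | i) (j | j)
  · obtain rfl := Subsingleton.elim i j
    rw [transpose_mul_mul_apply]
    refine (hv (⅟2 * (1 - q)) (⅟2 * (1 - q))).trans ?_
    simp only [fromBlocks_apply₁₁, one_apply_eq]
    linear_combination (1 - q) * h3
  · rw [transpose_mul_mul_apply]
    refine (hv (⅟2 * (1 - q)) (⅟2 * (-1 - q))).trans ?_
    simp only [fromBlocks_apply₁₂, Matrix.zero_apply]
    linear_combination (-q) * h3
  · rw [transpose_mul_mul_apply]
    refine (hv (⅟2 * (-1 - q)) (⅟2 * (1 - q))).trans ?_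
    simp only [fromBlocks_apply₂₁, Matrix.zero_apply]
    linear_combination (-q) * h3
  · obtain rfl := Subsingleton.elim i j
    rw [transpose_mul_mul_apply]
    refine (hv (⅟2 * (-1 - q)) (⅟2 * (-1 - q))).trans ?_
    simp only [fromBlocks_apply₂₂, Matrix.neg_apply, one_apply_eq]
    linear_combination (-1 - q) * h3

theorem Isotropic.exists_cong_dsum_hyp {F : Type*} [Field F] [Invertible (2 : F)]
    {G : Matrix m m F} (hG : G.IsSymm) (hu : IsUnit G) (h : Isotropic G) :
    ∃ (n : ℕ) (G' : Matrix (Fin n) (Fin n) F), Cong G (dsum (hyp F 1) G') := by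
  obtain ⟨x, hx, h0⟩ := h
  obtain ⟨i, hi⟩ := Function.ne_iff.mp hx
  exact HasseQF.exists_cong_dsum_hyp hG hu (f := Pi.single i (x i)⁻¹) (x := x)
    (by simpa using inv_mul_cancel₀ hi) h0

end Hyperbolic

end HasseQF

namespace HasseQF

open Matrix

/-! ### Pfister forms are round, and hyperbolic when isotropic -/

section Pfister

variable {F : Type*} [Field F]

/-- The index type of the diagonal entries of a Pfister form. -/
def PIdx : List F → Type
  | [] => Unit
  | _ :: l => PIdx l ⊕ PIdx l

instance instFintypePIdx : (l : List F) → Fintype (PIdx l)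
  | [] => inferInstanceAs (Fintype Unit)
  | _ :: l => letI := instFintypePIdx l; inferInstanceAs (Fintype (PIdx l ⊕ PIdx l))

instance instDecidableEqPIdx : (l : List F) → DecidableEq (PIdx l)
  | [] => inferInstanceAs (DecidableEq Unit)
  | _ :: l => letI := instDecidableEqPIdx l; inferInstanceAs (DecidableEq (PIdx l ⊕ PIdx l))

theorem card_PIdx_pos : (l : List F) → 0 < Fintype.card (PIdx l)
  | [] => Fintype.card_pos (α := Unit)
  | _ :: l => (card_PIdx_pos l).trans_le
      ((Nat.le_add_right _ _).trans_eq (Fintype.card_sum (α := PIdx l) (β := PIdx l)).symm)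

/-- The diagonal entries of the Pfister form `⟨⟨a₁, …, aₙ⟩⟩`. -/
def pfisterWeight : (l : List F) → PIdx l → F
  | [] => fun _ ↦ 1
  | a :: l => Sum.elim (pfisterWeight l) (a • pfisterWeight l)

/-- The diagonal matrix of the Pfister form `⟨⟨a₁, …, aₙ⟩⟩`. -/
def pfisterMatrix (l : List F) : Matrix (PIdx l) (PIdx l) F := diagonal (pfisterWeight l)

theorem cong_pfisterMatrix_nil : Cong (pfisterMatrix ([] : List F)) (1 : Matrix Unit Unit F) := by
  rw [← diagonal_one]
  exact Cong.refl (diagonal fun _ : Unit ↦ (1 : F))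

theorem cong_pfisterMatrix_cons (a : F) (l : List F) :
    Cong (pfisterMatrix (a :: l)) (dsum (pfisterMatrix l) (a • pfisterMatrix l)) := by
  rw [pfisterMatrix, pfisterMatrix, ← diagonal_smul, dsum_diagonal]
  exact Cong.refl (diagonal (Sum.elim (pfisterWeight l) (a • pfisterWeight l)))

theorem pfisterWeight_ne_zero {l : List F} (hl : ∀ a ∈ l, a ≠ 0) (i : PIdx l) :
    pfisterWeight l i ≠ 0 := by
  induction l with
  | nil => exact one_ne_zero
  | cons a l ih =>
    rw [List.forall_mem_cons] at hl
    rcases i with i | i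
    · exact ih hl.2 i
    · exact mul_ne_zero hl.1 (ih hl.2 i)

theorem isUnit_diagonal {ι : Type*} [Fintype ι] [DecidableEq ι] {w : ι → F} (hw : ∀ i, w i ≠ 0) :
    IsUnit (diagonal w) := by
  rw [isUnit_iff_isUnit_det, det_diagonal, isUnit_iff_ne_zero]
  exact Finset.prod_ne_zero_iff.mpr fun i _ ↦ hw i

theorem isSymm_pfisterMatrix (l : List F) : (pfisterMatrix l).IsSymm := diagonal_transpose _

theorem isUnit_pfisterMatrix {l : List F} (hl : ∀ a ∈ l, a ≠ 0) : IsUnit (pfisterMatrix l) :=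
  isUnit_diagonal (pfisterWeight_ne_zero hl)

theorem cong_map_pfisterMatrix {K : Type*} [Field K] (f : F →+* K) (l : List F) :
    Cong ((pfisterMatrix l).map f) (pfisterMatrix (l.map f)) := by
  induction l with
  | nil =>
    refine (cong_pfisterMatrix_nil.map f).trans ?_
    rw [Matrix.map_one _ f.map_zero f.map_one]
    exact cong_pfisterMatrix_nil.symm
  | cons a l ih =>
    refine ((cong_pfisterMatrix_cons a l).map f).trans ?_
    refine Cong.trans ?_ (cong_pfisterMatrix_cons (f a) (l.map f)).symm
    rw [map_dsum]
    refine ih.add ?_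
    rw [show (a • pfisterMatrix l).map f = f a • (pfisterMatrix l).map f by ext i j; simp]
    exact ih.smul _

variable {m n : Type*} [Fintype m] [DecidableEq m] [Fintype n] [DecidableEq n]

theorem cong_smul_sq {c : F} (hc : c ≠ 0) (N : Matrix m m F) : Cong N ((c * c) • N) := by
  refine ⟨c • 1, c⁻¹ • 1, ?_, ?_, ?_⟩
  · rw [Matrix.smul_mul, Matrix.mul_smul, smul_smul, mul_inv_cancel₀ hc, one_smul, Matrix.one_mul]
  · rw [Matrix.smul_mul, Matrix.mul_smul, smul_smul, inv_mul_cancel₀ hc, one_smul, Matrix.one_mul]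
  · simp [smul_smul]

/-- This is `⟨b, d⟩ ≃ ⟨b + d, b d (b + d)⟩` tensored with `N`: the vector `(1, 1)` has value `b +
d`, and the orthogonal vector `(-d, b)` has value `b d (b + d)`. -/
theorem cong_dsum_smul {b d : F} (hc : b + d ≠ 0) (N : Matrix m m F) :
    Cong (dsum (b • N) (d • N)) (dsum ((b + d) • N) ((b * d * (b + d)) • N)) := by
  refine ⟨fromBlocks (1 : Matrix m m F) (-d • 1) (1 : Matrix m m F) (b • 1),
    (b + d)⁻¹ • fromBlocks (b • 1) (d • 1) (-1 : Matrix m m F) (1 : Matrix m m F), ?_, ?_, ?_⟩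
  · rw [Matrix.mul_smul, fromBlocks_multiply, ← fromBlocks_one, fromBlocks_smul]
    have h : ((b + d)⁻¹ * (b + d)) • (1 : Matrix m m F) = 1 := by
      rw [inv_mul_cancel₀ hc, one_smul]
    congr 1 <;> simp only [Matrix.one_mul, Matrix.mul_neg, Matrix.mul_one]
    · exact Eq.trans (by module) h
    · module
    · module
    · exact Eq.trans (by module) h
  · rw [Matrix.smul_mul, fromBlocks_multiply, ← fromBlocks_one, fromBlocks_smul]
    have h : ((b + d)⁻¹ * (b + d)) • (1 : Matrix m m F) = 1 := by
      rw [inv_mul_cancel₀ hc, one_smul]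
    congr 1 <;>
      simp only [Matrix.mul_smul, Matrix.mul_one]
    · exact Eq.trans (by module) h
    · module
    · module
    · exact Eq.trans (by module) h
  · rw [fromBlocks_transpose, fromBlocks_multiply, fromBlocks_multiply]
    congr 1 <;> simp only [transpose_one, transpose_smul, Matrix.one_mul, Matrix.smul_mul,
      Matrix.mul_smul, Matrix.mul_one, Matrix.mul_zero, add_zero, zero_add] <;>
      module

theorem sumElim_dotProduct_dsum (A : Matrix m m F) (B : Matrix n n F) (y : m → F) (z : n → F) :
    Sum.elim y z ⬝ᵥ dsum A B *ᵥ Sum.elim y z = y ⬝ᵥ A *ᵥ y + z ⬝ᵥ B *ᵥ z := by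
  simp [fromBlocks_mulVec]

/-- A form is round if it is isometric to its multiples by the nonzero values it represents. -/
def IsRound (M : Matrix m m F) : Prop := ∀ x, x ⬝ᵥ M *ᵥ x ≠ 0 → Cong M ((x ⬝ᵥ M *ᵥ x) • M)

theorem IsRound.congr {M : Matrix m m F} {N : Matrix n n F} (hM : IsRound M) (h : Cong M N) :
    IsRound N := by
  obtain ⟨P, P', h1, h2, rfl⟩ := h
  intro x hx
  rw [dotProduct_cong_mulVec] at hx ⊢
  have e : Cong M (Pᵀ * M * P) := ⟨P, P', h1, h2, rfl⟩
  exact e.symm.trans ((hM _ hx).trans (e.smul _))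

theorem isRound_one : IsRound (1 : Matrix Unit Unit F) := by
  intro x hx
  have : x ⬝ᵥ (1 : Matrix Unit Unit F) *ᵥ x = x () * x () := by
    rw [one_mulVec]
    exact Fintype.sum_unique _
  rw [this] at hx ⊢
  exact cong_smul_sq (left_ne_zero_of_mul hx) _

/-- Let `b` and `d` be the values of `M` at the two halves of a vector. If both are nonzero,
roundness gives `M ⊥ aM ≃ bM ⊥ adM ≃ (b + ad)(M ⊥ abdM)`, and `bdM ≃ M`. If one of them vanishes,
the other gives the similarity directly, with the summands exchanged when `b = 0`. -/
theorem IsRound.dsum_smul {M : Matrix m m F} (hM : IsRound M) {a : F} (ha : a ≠ 0) :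
    IsRound (dsum M (a • M)) := by
  intro x hx
  obtain ⟨y, z, rfl⟩ : ∃ y z, x = Sum.elim y z :=
    ⟨x ∘ Sum.inl, x ∘ Sum.inr, (Sum.elim_comp_inl_inr x).symm⟩
  rw [sumElim_dotProduct_dsum, smul_mulVec, dotProduct_smul, smul_eq_mul] at *
  have ihy := hM y
  have ihz := hM z
  generalize y ⬝ᵥ M *ᵥ y = b at *
  generalize z ⬝ᵥ M *ᵥ z = d at *
  rw [smul_dsum]
  by_cases hb : b = 0
  · subst hb
    simp only [zero_add] at hx ⊢
    have hd := ihz (right_ne_zero_of_mul hx)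
    refine (cong_dsum_comm _ _).trans (Cong.add ?_ ?_)
    · have := hd.smul a
      rwa [smul_smul] at this
    · have := hd.trans (cong_smul_sq ha _)
      rwa [smul_smul, show a * a * d = a * d * a by ring, ← smul_smul] at this
  by_cases hd : d = 0
  · subst hd
    simp only [mul_zero, add_zero] at hx ⊢
    refine Cong.add (ihy hx) ?_
    have := (ihy hx).smul a
    rwa [smul_comm] at this
  have hy := ihy hb
  have hz := (ihz hd).smul a
  rw [smul_smul] at hz
  refine (hy.add hz).trans ((cong_dsum_smul hx M).trans ((Cong.refl _).add ?_))
  have := ((hy.trans ((ihz hd).smul b)).smul ((b + a * d) * a)).symm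
  rwa [smul_smul, smul_smul, show (b + a * d) * a * b * d = b * (a * d) * (b + a * d) by ring,
    ← smul_smul _ a] at this

/-- Pfister forms are round. -/
theorem isRound_pfisterMatrix {l : List F} (hl : ∀ a ∈ l, a ≠ 0) : IsRound (pfisterMatrix l) := by
  induction l with
  | nil => exact isRound_one.congr cong_pfisterMatrix_nil.symm
  | cons a l ih =>
    rw [List.forall_mem_cons] at hl
    exact ((ih hl.2).dsum_smul hl.1).congr (cong_pfisterMatrix_cons a l).symm

/-- An isotropic Pfister form is hyperbolic. -/
theorem isHyp_pfisterMatrix_of_isotropic [Invertible (2 : F)] {l : List F} (hl : ∀ a ∈ l, a ≠ 0)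
    (h : Isotropic (pfisterMatrix l)) : IsHyp (pfisterMatrix l) := by
  induction l with
  | nil =>
    obtain ⟨x, hx, h0⟩ := cong_pfisterMatrix_nil.symm.isotropic h
    rw [one_mulVec] at h0
    have : x () * x () = 0 := (Fintype.sum_unique _).symm.trans h0
    exact absurd (funext fun _ ↦ mul_self_eq_zero.mp this) hx
  | cons a l ih =>
    rw [List.forall_mem_cons] at hl
    obtain ⟨ha, hl⟩ := hl
    refine IsHyp.congr ?_ (cong_pfisterMatrix_cons a l)
    replace h := (cong_pfisterMatrix_cons a l).symm.isotropic h
    by_cases hi : Isotropic (pfisterMatrix l)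
    · exact (ih hl hi).add ((ih hl hi).smul ha.isUnit)
    obtain ⟨x, hx, h0⟩ := h
    obtain ⟨y, z, rfl⟩ : ∃ y z, x = Sum.elim y z :=
      ⟨x ∘ Sum.inl, x ∘ Sum.inr, (Sum.elim_comp_inl_inr x).symm⟩
    rw [sumElim_dotProduct_dsum, smul_mulVec, dotProduct_smul, smul_eq_mul] at h0
    have hne (y : PIdx l → F) (hy : y ⬝ᵥ pfisterMatrix l *ᵥ y = 0) : y = 0 := by
      by_contra hy'
      exact hi ⟨y, hy', hy⟩
    have hd : z ⬝ᵥ pfisterMatrix l *ᵥ z ≠ 0 := by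
      intro hz
      rw [hz, mul_zero, add_zero] at h0
      rw [hne _ h0, hne _ hz] at hx
      exact hx (by ext (i | i) <;> rfl)
    have hb : y ⬝ᵥ pfisterMatrix l *ᵥ y ≠ 0 := by
      intro hy
      rw [hy, zero_add] at h0
      exact mul_ne_zero ha hd h0
    -- Now `b + a d = 0` with `b` and `d` nonzero, so roundness gives `aM ≃ adM = -bM ≃ -M`, and the
    -- form is `M ⊥ -M`.
    have hy := isRound_pfisterMatrix hl y hb
    have hz := (isRound_pfisterMatrix hl z hd).smul a
    rw [smul_smul, eq_neg_of_add_eq_zero_right h0, neg_smul] at hz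
    exact (isHyp_dsum_neg (isSymm_pfisterMatrix l) (isUnit_pfisterMatrix hl)).congr
      ((Cong.refl _).add (hz.trans hy.neg.symm))

end Pfister

end HasseQF

namespace HasseQF

open Matrix Polynomial

/-! ### Hermite reduction and Harder's theorem over `k[X]` -/

section Harder

/-- The factor `g` generates the ideal of the coordinates, and `f` is a Bézout relation. -/
theorem exists_unimodular_smul {R : Type*} [CommRing R] [IsDomain R] [IsPrincipalIdealRing R]
    {n : Type*} [Fintype n] {x : n → R} (hx : x ≠ 0) :
    ∃ (g : R) (x' f : n → R), g ≠ 0 ∧ x = g • x' ∧ f ⬝ᵥ x' = 1 := by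
  obtain ⟨g, hg⟩ := (IsPrincipalIdealRing.principal (Ideal.span (Set.range x))).principal
  have h1 (i : n) : ∃ c, x i = g * c := by
    have : x i ∈ Ideal.span (Set.range x) := Ideal.subset_span ⟨i, rfl⟩
    rw [hg, Ideal.submodule_span_eq, Ideal.mem_span_singleton'] at this
    obtain ⟨c, hc⟩ := this
    exact ⟨c, by rw [mul_comm, hc]⟩
  choose x' hx' using h1
  have h2 : g ∈ Ideal.span (Set.range x) := by
    rw [hg]
    exact Submodule.mem_span_singleton_self g
  obtain ⟨f, hf⟩ := (Ideal.mem_span_range_iff_exists_fun).mp h2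
  have hg0 : g ≠ 0 := by
    rintro rfl
    exact hx (funext fun i ↦ by rw [hx' i, zero_mul, Pi.zero_apply])
  refine ⟨g, x', f, hg0, funext hx', mul_left_cancel₀ hg0 ?_⟩
  rw [mul_one]
  nth_rewrite 2 [← hf]
  rw [dotProduct, Finset.mul_sum]
  exact Finset.sum_congr rfl fun i _ ↦ by rw [hx' i]; ring

variable {k : Type*} [Field k]

/-- Completing the square. -/
theorem dotProduct_fromBlocks_unit {R : Type*} [CommRing R] {m : Type*} [Fintype m] (a : R)
    (r : Matrix Unit m R) (C : Matrix m m R) (s : R) (y : m → R) :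
    a * (Sum.elim (fun _ : Unit ↦ s) y ⬝ᵥ fromBlocks (of fun _ _ : Unit ↦ a) r rᵀ C *ᵥ
      Sum.elim (fun _ : Unit ↦ s) y) =
      (a * s + (r *ᵥ y) ()) ^ 2 + y ⬝ᵥ (a • C - rᵀ * r) *ᵥ y := by
  have h1 : y ⬝ᵥ (rᵀ * r) *ᵥ y = (r *ᵥ y) () ^ 2 := by
    rw [← mulVec_mulVec, dotProduct_mulVec, vecMul_transpose, sq]
    exact Fintype.sum_unique _
  have h2 : y ⬝ᵥ (rᵀ *ᵥ fun _ ↦ s) = s * (r *ᵥ y) () := by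
    rw [dotProduct_mulVec, vecMul_transpose, mul_comm]
    exact Fintype.sum_unique _
  have h3 : ((of fun _ _ : Unit ↦ a) *ᵥ fun _ ↦ s) () = a * s := by
    simp [mulVec, dotProduct]
  have h4 : (fun _ : Unit ↦ s) ⬝ᵥ ((of fun _ _ : Unit ↦ a) *ᵥ (fun _ ↦ s) + r *ᵥ y) =
      s * (a * s + (r *ᵥ y) ()) := by
    rw [← h3]
    exact Fintype.sum_unique _
  rw [sub_mulVec, dotProduct_sub, h1, smul_mulVec, dotProduct_smul, fromBlocks_mulVec]
  simp only [Sum.elim_comp_inl, Sum.elim_comp_inr, sumElim_dotProduct_sumElim]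
  rw [h4, dotProduct_add, h2, smul_eq_mul]
  ring

/-- A lower triangular matrix of determinant `a ^ card m` clears the first column and leaves the
Schur complement scaled by `a`, so nothing is divided by `a`. -/
theorem det_fromBlocks_unit {R : Type*} [CommRing R] {m : Type*} [Fintype m] [DecidableEq m]
    (a : R) (r : Matrix Unit m R) (C : Matrix m m R) :
    a ^ Fintype.card m * (fromBlocks (of fun _ _ : Unit ↦ a) r rᵀ C).det =
      a * (a • C - rᵀ * r).det := by
  have h : fromBlocks (1 : Matrix Unit Unit R) 0 (-rᵀ) (a • 1) *
      fromBlocks (of fun _ _ : Unit ↦ a) r rᵀ C =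
        fromBlocks (of fun _ _ : Unit ↦ a) r 0 (a • C - rᵀ * r) := by
    rw [fromBlocks_multiply]
    congr 1
    · simp
    · simp
    · ext i j
      simp [Matrix.mul_apply, mul_comm]
    · simp [sub_eq_add_neg, add_comm]
  have := congrArg det h
  rwa [det_mul, det_fromBlocks_zero₁₂, det_fromBlocks_zero₂₁, det_one, one_mul, det_smul, det_one,
    mul_one, det_unique (of fun _ _ : Unit ↦ a)] at this

/-- Hermite's bound for anisotropic forms over `k[X]`. -/
theorem exists_unimodular_natDegree_le (n : ℕ) (G : Matrix (Fin (n + 1)) (Fin (n + 1)) k[X])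
    (hG : G.IsSymm) (ha : ¬ Isotropic G) :
    ∃ x f : Fin (n + 1) → k[X], f ⬝ᵥ x = 1 ∧
      (n + 1) * (x ⬝ᵥ G *ᵥ x).natDegree ≤ G.det.natDegree := by
  induction n with
  | zero =>
    refine ⟨1, 1, by simp, ?_⟩
    simp [dotProduct, mulVec]
  | succ n ih =>
    let S : Set (Fin (n + 2) → k[X]) := {x | ∃ f : Fin (n + 2) → k[X], f ⬝ᵥ x = 1}
    have hS : S.Nonempty := ⟨Pi.single 0 1, Pi.single 0 1, by simp⟩
    let φ : (Fin (n + 2) → k[X]) → ℕ := fun x ↦ (x ⬝ᵥ G *ᵥ x).natDegree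
    -- Take a unimodular vector whose value has least degree and complete it to a basis.
    obtain ⟨x, ⟨f, hfx⟩, hmin⟩ : ∃ x ∈ S, ∀ y ∈ S, φ x ≤ φ y :=
      ⟨Function.argminOn φ S hS, Function.argminOn_mem _ _ _,
        fun y hy ↦ Function.argminOn_le _ _ hy⟩
    refine ⟨x, f, hfx, ?_⟩
    obtain ⟨m, Y, C, -, h1, h2⟩ := exists_fromCols_isUnit (M := replicateRow Unit f)
      (Z := replicateCol Unit x) (by
        ext i j : 1
        rw [one_apply_eq]
        exact hfx)
    set P := fromCols (replicateCol Unit x) Y with hP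
    set P' := fromRows (replicateRow Unit f) C
    have hcong : Cong G (Pᵀ * G * P) := ⟨P, P', h1, h2, rfl⟩
    have hm : m = n + 1 := by
      have := hcong.card_eq
      simp at this
      omega
    subst hm
    have ha' : ∀ z, z ≠ 0 → z ⬝ᵥ (Pᵀ * G * P) *ᵥ z ≠ 0 := fun z hz h0 ↦
      ha (hcong.isotropic ⟨z, hz, h0⟩)
    have hmin' : ∀ z g, g ⬝ᵥ z = 1 → φ x ≤ (z ⬝ᵥ (Pᵀ * G * P) *ᵥ z).natDegree := by
      intro z g hgz
      rw [dotProduct_cong_mulVec]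
      refine hmin _ ⟨g ᵥ* P', ?_⟩
      rw [← dotProduct_mulVec, mulVec_mulVec, h2, one_mulVec, hgz]
    obtain ⟨u, hu⟩ := hcong.exists_det
    have hdeg : (Pᵀ * G * P).det.natDegree = G.det.natDegree := by
      by_cases h0 : G.det = 0
      · rw [hu, h0, mul_zero]
      · rw [hu, natDegree_mul (pow_ne_zero _ u.ne_zero) h0, natDegree_pow,
          natDegree_eq_zero_of_isUnit u.isUnit, mul_zero, zero_add]
    have hG1 := hcong.isSymm hG
    have h11 : Pᵀ * G * P = fromBlocks (of fun _ _ : Unit ↦ x ⬝ᵥ G *ᵥ x)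
        (Pᵀ * G * P).toBlocks₁₂ (Pᵀ * G * P).toBlocks₁₂ᵀ (Pᵀ * G * P).toBlocks₂₂ := by
      ext (i | i) (j | j) : 1
      · rw [transpose_mul_mul_apply]
        rfl
      · rfl
      · exact (hG1.apply _ _).symm
      · rfl
    have hC : (Pᵀ * G * P).toBlocks₂₂.IsSymm := by
      ext i j : 1
      exact hG1.apply _ _
    generalize (Pᵀ * G * P).toBlocks₁₂ = r at h11
    generalize (Pᵀ * G * P).toBlocks₂₂ = D at h11 hC
    rw [← hdeg]
    change ((n + 1 : ℕ) + 1) * φ x ≤ _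
    have hφ : φ x = (x ⬝ᵥ G *ᵥ x).natDegree := rfl
    have hx0 : x ⬝ᵥ G *ᵥ x ≠ 0 := by
      intro h0
      refine ha ⟨x, ?_, h0⟩
      rintro rfl
      simp at hfx
    rw [h11] at ha' hmin' ⊢
    clear hmin
    generalize φ x = d at *
    generalize x ⬝ᵥ G *ᵥ x = a at *
    -- A zero `y` of the scaled Schur complement yields the zero `(-r y, a y)` of the whole form,
    -- since its completed square vanishes.
    have hani : ¬ Isotropic (a • D - rᵀ * r) := by
      rintro ⟨y, hy, h0⟩
      refine ha' (Sum.elim (fun _ ↦ -(r *ᵥ y) ()) (a • y)) (fun h ↦ hy ?_) ?_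
      · funext i
        have := congrFun h (Sum.inr i)
        simpa [hx0] using this
      · refine mul_left_cancel₀ hx0 ?_
        rw [dotProduct_fromBlocks_unit, mulVec_smul, mulVec_smul, dotProduct_smul, smul_dotProduct,
          h0]
        simp
    have hsymm : (a • D - rᵀ * r).IsSymm := by
      simp [Matrix.IsSymm, hC.eq]
    obtain ⟨y, g, hgy, hdet⟩ := ih _ hsymm hani
    have hy : y ≠ 0 := by
      rintro rfl
      simp at hgy
    -- Lift `y` with the first coordinate given by Euclidean division, so that the completed square
    -- becomes the square of the remainder of `r y` modulo `a`. The lift is unimodular because `y`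
    -- is, so its value `b` has degree at least `d`.
    have hφ1 := dotProduct_fromBlocks_unit a r D (-((r *ᵥ y) () / a)) y
    have hne := ha' (Sum.elim (fun _ ↦ -((r *ᵥ y) () / a)) y)
      (fun h ↦ hy (funext fun i ↦ congrFun h (Sum.inr i)))
    have hle := hmin' (Sum.elim (fun _ ↦ -((r *ᵥ y) () / a)) y) (Sum.elim 0 g) (by simpa using hgy)
    have hD := det_fromBlocks_unit a r D
    rw [Fintype.card_fin] at hD
    generalize (fromBlocks (of fun _ _ : Unit ↦ a) r rᵀ D).det = δ at *
    generalize (fromBlocks (of fun _ _ : Unit ↦ a) r rᵀ D) = G1 at *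
    generalize Sum.elim (fun _ ↦ -((r *ᵥ y) () / a)) y ⬝ᵥ
      G1 *ᵥ Sum.elim (fun _ ↦ -((r *ᵥ y) () / a)) y = b at *
    generalize (a • D - rᵀ * r).det = ε at *
    have hmod : a * -((r *ᵥ y) () / a) + (r *ᵥ y) () = (r *ᵥ y) () % a := by
      linear_combination -EuclideanDomain.div_add_mod ((r *ᵥ y) ()) a
    rw [hmod] at hφ1
    have hρ : ((r *ᵥ y) () % a).degree < a.degree := EuclideanDomain.mod_lt _ hx0
    generalize (r *ᵥ y) () % a = ρ at *
    -- Here `deg ρ < deg a = d ≤ deg b`. Hence the value `a * b - ρ ^ 2` of the Schur complement has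
    -- degree at least `2 d`.
    have hlt : (ρ ^ 2).degree < (a * b).degree := by
      by_cases hρ0 : ρ = 0
      · rw [hρ0, zero_pow two_ne_zero, degree_zero, bot_lt_iff_ne_bot, Ne, degree_eq_bot]
        exact mul_ne_zero hx0 hne
      · rw [degree_eq_natDegree hρ0, degree_eq_natDegree hx0, Nat.cast_lt] at hρ
        rw [degree_eq_natDegree (pow_ne_zero 2 hρ0), degree_eq_natDegree (mul_ne_zero hx0 hne),
          Nat.cast_lt, natDegree_pow, natDegree_mul hx0 hne]
        omega
    have hval : y ⬝ᵥ (a • D - rᵀ * r) *ᵥ y = a * b - ρ ^ 2 := by rw [hφ1]; ring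
    have hdeg2 : 2 * d ≤ (y ⬝ᵥ (a • D - rᵀ * r) *ᵥ y).natDegree := by
      rw [hval, natDegree_eq_of_degree_eq (degree_sub_eq_left_of_degree_lt hlt),
        natDegree_mul hx0 hne]
      omega
    have h3 : (n + 1) * (2 * d) ≤ ε.natDegree := (Nat.mul_le_mul_left _ hdeg2).trans hdet
    -- As the zero polynomial has `natDegree` 0, `ε = 0` forces `d = 0`. Otherwise `a ^ (n + 1) * δ
    -- = a * ε` gives `deg δ = deg ε - n d`, which is at least `(n + 2) d`.
    by_cases hε : ε = 0
    · rw [hε, natDegree_zero] at h3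
      have : d = 0 := by
        rcases Nat.mul_eq_zero.mp (Nat.le_zero.mp h3) with h | h <;> omega
      simp [this]
    · have hδ : δ ≠ 0 := by
        rintro rfl
        rw [mul_zero, eq_comm, mul_eq_zero] at hD
        exact hD.elim hx0 hε
      have := congrArg natDegree hD
      rw [natDegree_mul (pow_ne_zero _ hx0) hδ, natDegree_mul hx0 hε, natDegree_pow, ← hφ] at this
      nlinarith

/-- A nonempty unimodular form over `k[X]` either has an isotropic unimodular vector or represents
a unit. -/
theorem exists_isUnit_value {n : ℕ} {G : Matrix (Fin (n + 1)) (Fin (n + 1)) k[X]}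
    (hG : G.IsSymm) (hu : IsUnit G) (ha : ¬ Isotropic G) : ∃ x, IsUnit (x ⬝ᵥ G *ᵥ x) := by
  obtain ⟨x, f, hfx, hle⟩ := exists_unimodular_natDegree_le n G hG ha
  refine ⟨x, ?_⟩
  -- A unit determinant has degree 0, so Hermite's bound makes the value constant; anisotropy makes
  -- it nonzero.
  rw [natDegree_eq_zero_of_isUnit ((isUnit_iff_isUnit_det _).mp hu), Nat.le_zero,
    Nat.mul_eq_zero] at hle
  have h0 := hle.resolve_left (Nat.succ_ne_zero _)
  rw [eq_C_of_natDegree_eq_zero h0, isUnit_C, isUnit_iff_ne_zero]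
  intro h
  rw [← C_eq_zero, ← eq_C_of_natDegree_eq_zero h0] at h
  refine ha ⟨x, ?_, h⟩
  rintro rfl
  simp at hfx

/-- Harder's theorem: unimodular symmetric matrices over `k[X]` are congruent to constant ones. -/
theorem exists_cong_map_C (h2 : (2 : k) ≠ 0) {ι : Type*} [Fintype ι] [DecidableEq ι]
    {G : Matrix ι ι k[X]} (hG : G.IsSymm) (hu : IsUnit G) :
    ∃ (n : ℕ) (D : Matrix (Fin n) (Fin n) k), Cong G (D.map C) := by
  have key (N : ℕ) : ∀ n, n ≤ N → ∀ G : Matrix (Fin n) (Fin n) k[X], G.IsSymm → IsUnit G →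
      ∃ (n : ℕ) (D : Matrix (Fin n) (Fin n) k), Cong G (D.map C) := by
    induction N with
    | zero =>
      intro n hn G hG hu
      obtain rfl := Nat.le_zero.mp hn
      refine ⟨0, 0, ?_⟩
      rw [Subsingleton.elim (Matrix.map 0 C) G]
      exact Cong.refl G
    | succ N ih =>
      intro n hn G hG hu
      obtain _ | n := n
      · exact ih 0 (Nat.zero_le _) G hG hu
      -- Once a nonempty constant summand splits off, the complement is smaller and the induction
      -- applies to it. The summand is a hyperbolic plane in the isotropic case and `⟨c⟩`, with `c`
      -- a represented unit, otherwise.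
      have split {ι : Type} [Fintype ι]
          [DecidableEq ι] (E : Matrix ι ι k) {m : ℕ} {G' : Matrix (Fin m) (Fin m) k[X]}
          (hι : 0 < Fintype.card ι) (h : Cong G (dsum (E.map C) G')) :
          ∃ (n : ℕ) (D : Matrix (Fin n) (Fin n) k), Cong G (D.map C) := by
        have hm := h.card_eq
        simp only [Fintype.card_fin, Fintype.card_sum] at hm
        obtain ⟨q, D, hD⟩ := ih m (by omega) G' ((isSymm_dsum_iff _ _).mp (h.isSymm hG)).2
          ((isUnit_dsum_iff _ _).mp (h.isUnit hu)).2
        have e := cong_submatrix (dsum E D) (Fintype.equivFin (ι ⊕ Fin q)).symm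
        have h' := h.trans ((Cong.refl _).add hD)
        rw [← map_dsum] at h'
        exact ⟨_, _, h'.trans (e.map C)⟩
      by_cases hi : Isotropic G
      · obtain ⟨x, hx, h0⟩ := hi
        obtain ⟨g, x', f, hg, rfl, hfx⟩ := exists_unimodular_smul hx
        have h0' : x' ⬝ᵥ G *ᵥ x' = 0 := by
          simpa [mulVec_smul, hg] using h0
        have h2' : IsUnit (2 : k[X]) := by
          have := (isUnit_iff_ne_zero.mpr h2).map (C : k →+* k[X])
          rwa [map_ofNat] at this
        let := h2'.invertible
        obtain ⟨m, G', h⟩ := exists_cong_dsum_hyp hG hu hfx h0'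
        rw [← map_hyp C] at h
        exact split _ (by simp) h
      · obtain ⟨x, hx⟩ := exists_isUnit_value hG hu hi
        obtain ⟨c, hc, hcx⟩ := Polynomial.isUnit_iff.mp hx
        obtain ⟨m, G', h⟩ := exists_cong_dsum hG (replicateCol Unit x)
          (H := (diagonal fun _ : Unit ↦ c).map C) (by
            ext i j : 1
            rw [transpose_mul_mul_apply]
            simpa using! hcx.symm) (by
            rw [diagonal_map (map_zero C), isUnit_iff_isUnit_det, det_diagonal]
            simpa [hcx] using hx)
        exact split _ (by simp) h
  have e := cong_submatrix G (Fintype.equivFin ι).symm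
  obtain ⟨n, D, h⟩ := key _ _ le_rfl _ (e.isSymm hG) (e.isUnit hu)
  exact ⟨n, D, e.trans h⟩

end Harder

end HasseQF

namespace HasseQF

open Matrix IsDedekindDomain

/-! ### Gluing local unimodular lattices over a principal ideal domain -/

section Gluing

variable {A K : Type*} [CommRing A] [IsDomain A] [IsPrincipalIdealRing A] [Field K] [Algebra A K]
  [IsFractionRing A K]
variable {n : Type*} [Fintype n] [DecidableEq n]

/-- Smith normal form of an invertible matrix over the fraction field of a principal ideal
domain. -/
theorem exists_smith (T : Matrix n n K) (hT : IsUnit T) :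
    ∃ (B C : Matrix n n A) (a : n → K), IsUnit B ∧ IsUnit C ∧ (∀ i, a i ≠ 0) ∧
      T = B.map (algebraMap A K) * diagonal a * C.map (algebraMap A K) := by
  obtain ⟨d, hd⟩ := IsLocalization.exist_integer_multiples_of_finite (nonZeroDivisors A)
    fun ij : n × n ↦ T ij.1 ij.2
  choose T₀ hT₀ using hd
  have hd0 : algebraMap A K d ≠ 0 := IsFractionRing.to_map_ne_zero_of_mem_nonZeroDivisors d.2
  let M : Matrix n n A := of fun i j ↦ T₀ (i, j)
  have hM : M.map (algebraMap A K) = algebraMap A K d • T := by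
    ext i j
    simpa [M, Submonoid.smul_def, Algebra.smul_def] using! hT₀ (i, j)
  have hMinj : Function.Injective M.mulVecLin := by
    rw [coe_mulVecLin]
    refine mulVec_injective_of_det_ne_zero fun h0 ↦ ?_
    have h1 := congrArg det hM
    rw [← RingHom.mapMatrix_apply, ← RingHom.map_det, h0, map_zero, det_smul, eq_comm,
      mul_eq_zero] at h1
    exact h1.elim (pow_ne_zero _ hd0) ((isUnit_iff_isUnit_det _).mp hT).ne_zero
  -- After clearing denominators, `M` has a range of full rank. Bases `b` of the ambient module and
  -- `bN` of the range with `bN i = a i • b i` give the factorization; the right factor expresses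
  -- the columns of `M` in `bN`.
  let eN := LinearEquiv.ofInjective M.mulVecLin hMinj
  obtain ⟨b, a, bN, hab⟩ := Submodule.exists_smith_normal_form_of_rank_eq (Pi.basisFun A n)
    (N := LinearMap.range M.mulVecLin) (LinearEquiv.finrank_eq eN.symm)
  let bM : Module.Basis n A (LinearMap.range M.mulVecLin) := (Pi.basisFun A n).map eN
  have hfac : M = (Pi.basisFun A n).toMatrix b * diagonal a * bN.toMatrix bM := by
    ext i j
    have h1 : ((∑ l, bN.toMatrix bM l j • bN l : LinearMap.range M.mulVecLin) : n → A) i =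
        ((bM j : LinearMap.range M.mulVecLin) : n → A) i := by
      rw [bN.sum_toMatrix_smul_self]
    have h2 : ((bM j : LinearMap.range M.mulVecLin) : n → A) i = M i j := by
      simp [bM, eN]
    rw [← h2, ← h1, Matrix.mul_apply, Submodule.coe_sum, Finset.sum_apply]
    refine Finset.sum_congr rfl fun l _ ↦ ?_
    rw [Submodule.coe_smul, hab, mul_diagonal, Pi.smul_apply, Pi.smul_apply, smul_eq_mul,
      smul_eq_mul, Module.Basis.toMatrix_apply (Pi.basisFun A n), Pi.basisFun_repr]
    ring
  refine ⟨(Pi.basisFun A n).toMatrix b, bN.toMatrix bM, fun i ↦ (algebraMap A K d)⁻¹ * algebraMap A K (a i),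
    ⟨⟨_, _, Module.Basis.toMatrix_mul_toMatrix_flip _ _,
      Module.Basis.toMatrix_mul_toMatrix_flip _ _⟩, rfl⟩,
    ⟨⟨_, _, Module.Basis.toMatrix_mul_toMatrix_flip _ _,
      Module.Basis.toMatrix_mul_toMatrix_flip _ _⟩, rfl⟩, ?_, ?_⟩
  · intro i
    refine mul_ne_zero (inv_ne_zero hd0) ?_
    rw [Ne, FaithfulSMul.algebraMap_eq_zero_iff]
    intro h0
    refine bN.ne_zero i (Subtype.ext ?_)
    rw [hab, h0, zero_smul]
    rfl
  · have h3 : T = (algebraMap A K d)⁻¹ • M.map (algebraMap A K) := by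
      rw [hM, smul_smul, inv_mul_cancel₀ hd0, one_smul]
    refine h3.trans ((congrArg (fun X ↦ (algebraMap A K d)⁻¹ • X.map (algebraMap A K)) hfac).trans ?_)
    simp only [Matrix.map_mul]
    rw [diagonal_map (map_zero _), ← Matrix.smul_mul, ← Matrix.mul_smul, ← diagonal_smul]
    rfl

/-- A square matrix lies in `GL_n` of the valuation ring of `v`. -/
def IsUnimodular (v : Valuation K (WithZero (Multiplicative ℤ))) (M : Matrix n n K) : Prop :=
  (∀ i j, v (M i j) ≤ 1) ∧ v M.det = 1

variable {v : Valuation K (WithZero (Multiplicative ℤ))}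

theorem IsUnimodular.mul {M N : Matrix n n K} (hM : IsUnimodular v M) (hN : IsUnimodular v N) :
    IsUnimodular v (M * N) := by
  refine ⟨fun i j ↦ ?_, by rw [det_mul, map_mul, hM.2, hN.2, mul_one]⟩
  rw [Matrix.mul_apply]
  exact v.map_sum_le fun l _ ↦ by
    rw [map_mul]
    exact mul_le_one' (hM.1 _ _) (hN.1 _ _)

theorem IsUnimodular.transpose {M : Matrix n n K} (hM : IsUnimodular v M) :
    IsUnimodular v Mᵀ :=
  ⟨fun i j ↦ hM.1 j i, by rw [det_transpose, hM.2]⟩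

theorem isUnimodular_diagonal {a : n → K} (ha : ∀ i, v (a i) = 1) :
    IsUnimodular v (diagonal a) := by
  refine ⟨fun i j ↦ ?_, ?_⟩
  · rw [diagonal_apply]
    split_ifs
    · exact (ha i).le
    · simp
  · rw [det_diagonal, map_prod]
    exact Finset.prod_eq_one fun i _ ↦ ha i

theorem IsUnimodular.isUnit {M : Matrix n n K} (hM : IsUnimodular v M) : IsUnit M := by
  rw [isUnit_iff_isUnit_det, isUnit_iff_ne_zero]
  intro h
  have := hM.2
  rw [h, map_zero] at this
  exact zero_ne_one this

theorem valuation_algebraMap_isUnit (p : HeightOneSpectrum A) {a : A} (ha : IsUnit a) :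
    p.valuation K (algebraMap A K a) = 1 := by
  rw [HeightOneSpectrum.valuation_eq_one_iff_notMem]
  exact fun h ↦ p.isPrime.ne_top (Ideal.eq_top_of_isUnit_mem _ h ha)

theorem isUnimodular_map (p : HeightOneSpectrum A) {M : Matrix n n A} (hM : IsUnit M) :
    IsUnimodular (p.valuation K) (M.map (algebraMap A K)) := by
  refine ⟨fun i j ↦ p.valuation_le_one _, ?_⟩
  rw [← RingHom.mapMatrix_apply, ← RingHom.map_det]
  exact valuation_algebraMap_isUnit p ((isUnit_iff_isUnit_det _).mp hM)

/-- A power of a generator of `p` works: the generator lies in no other prime, because `p` is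
maximal. -/
theorem exists_valuation_eq (p : HeightOneSpectrum A) {a : K} (ha : a ≠ 0) :
    ∃ s : K, p.valuation K s = p.valuation K a ∧ ∀ q, q ≠ p → q.valuation K s = 1 := by
  obtain ⟨π, hπ⟩ := (IsPrincipalIdealRing.principal p.asIdeal).principal
  have hπ0 : π ≠ 0 := by
    rintro rfl
    exact p.ne_bot (by rw [hπ]; simp)
  have h1 : p.valuation K (algebraMap A K π) = WithZero.exp (-1) := by
    rw [HeightOneSpectrum.valuation_of_algebraMap, p.intValuation_singleton hπ0 hπ]
  have h2 (q : HeightOneSpectrum A) (hq : q ≠ p) : q.valuation K (algebraMap A K π) = 1 := by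
    rw [HeightOneSpectrum.valuation_eq_one_iff_notMem]
    intro h
    refine hq (HeightOneSpectrum.ext (p.isMaximal.eq_of_le q.isPrime.ne_top ?_).symm)
    rw [hπ]
    exact (Submodule.span_singleton_le_iff_mem _ _).mpr h
  have h3 : p.valuation K a ≠ 0 := (Valuation.ne_zero_iff _).mpr ha
  refine ⟨algebraMap A K π ^ (-WithZero.log (p.valuation K a)), ?_, fun q hq ↦ ?_⟩
  · rw [map_zpow₀, h1, ← WithZero.exp_zsmul]
    simp [WithZero.exp_log h3]
  · rw [map_zpow₀, h2 q hq, _root_.one_zpow]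

/-- An invertible matrix over the fraction field can be corrected at one prime to become
unimodular at all other primes. -/
theorem exists_isUnimodular_away (p : HeightOneSpectrum A) {T : Matrix n n K} (hT : IsUnit T) :
    ∃ S U : Matrix n n K, S = T * U ∧ IsUnit S ∧ (∀ q, q ≠ p → IsUnimodular (q.valuation K) S) ∧
      IsUnimodular (p.valuation K) U := by
  obtain ⟨B, C, a, hB, hC, ha, rfl⟩ := exists_smith (A := A) T hT
  choose s hs hs' using fun i ↦ exists_valuation_eq p (ha i)
  obtain ⟨⟨C, C', hCC, hCC'⟩, rfl⟩ := hC
  have hs0 (i : n) : s i ≠ 0 := by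
    rw [← Valuation.ne_zero_iff (p.valuation K), hs]
    exact (Valuation.ne_zero_iff _).mpr (ha i)
  -- Replace the diagonal factor `a` of `T = B a C` by `s`, which has the same valuations at `p` and
  -- valuation 1 at every other prime. Then `U = C⁻¹ a⁻¹ s` is unimodular at `p`.
  refine ⟨B.map (algebraMap A K) * diagonal s,
    C'.map (algebraMap A K) * diagonal fun i ↦ (a i)⁻¹ * s i, ?_, ?_, fun q hq ↦ ?_, ?_⟩
  · simp only [Matrix.mul_assoc]
    rw [← Matrix.mul_assoc (C.map _), ← Matrix.map_mul, hCC,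
      Matrix.map_one _ (map_zero _) (map_one _), Matrix.one_mul, diagonal_mul_diagonal]
    congr 2
    ext i
    rw [mul_inv_cancel_left₀ (ha i)]
  · exact (isUnimodular_map p hB).isUnit.mul (isUnit_diagonal hs0)
  · exact (isUnimodular_map q hB).mul (isUnimodular_diagonal fun i ↦ hs' i q hq)
  · refine (isUnimodular_map p ⟨⟨C', C, hCC', hCC⟩, rfl⟩).mul (isUnimodular_diagonal fun i ↦ ?_)
    rw [map_mul, map_inv₀, hs, inv_mul_cancel₀ ((Valuation.ne_zero_iff _).mpr (ha i))]

/-- A form that is unimodular at each prime, after a change of basis depending on the prime, is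
unimodular at all primes after a single change of basis. -/
theorem exists_isUnimodular_forall {G : Matrix n n K} (hG : IsUnit G)
    (h : ∀ q : HeightOneSpectrum A, ∃ T, IsUnit T ∧ IsUnimodular (q.valuation K) (Tᵀ * G * T)) :
    ∃ S, IsUnit S ∧ ∀ q : HeightOneSpectrum A, IsUnimodular (q.valuation K) (Sᵀ * G * S) := by
  classical
  -- Induction on a finite set containing the bad primes. The base change that repairs `p` is
  -- unimodular at all other primes, so it spoils none of the good ones.
  have key (B : Finset (HeightOneSpectrum A)) : ∀ G : Matrix n n K,
      (∀ q : HeightOneSpectrum A, q ∉ B → IsUnimodular (q.valuation K) G) →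
      (∀ q : HeightOneSpectrum A, ∃ T, IsUnit T ∧ IsUnimodular (q.valuation K) (Tᵀ * G * T)) →
      ∃ S, IsUnit S ∧ ∀ q : HeightOneSpectrum A, IsUnimodular (q.valuation K) (Sᵀ * G * S) := by
    induction B using Finset.induction_on with
    | empty =>
      intro G hG _
      exact ⟨1, isUnit_one, fun q ↦ by simpa using hG q (Finset.notMem_empty q)⟩
    | insert p B hp ih =>
      intro G hG hT
      obtain ⟨T, hTu, hTG⟩ := hT p
      obtain ⟨S, U, hSTU, hS, hSq, hU⟩ := exists_isUnimodular_away p hTu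
      have hB : ∀ q : HeightOneSpectrum A, q ∉ B → IsUnimodular (q.valuation K) (Sᵀ * G * S) := by
        intro q hq
        by_cases hqp : q = p
        · subst hqp
          have := (hU.transpose.mul hTG).mul hU
          rw [hSTU]
          simpa only [transpose_mul, Matrix.mul_assoc] using this
        · exact ((hSq q hqp).transpose.mul
            (hG q (by simp [hqp, hq]))).mul (hSq q hqp)
      have hloc : ∀ q : HeightOneSpectrum A, ∃ T, IsUnit T ∧
          IsUnimodular (q.valuation K) (Tᵀ * (Sᵀ * G * S) * T) := by
        intro q
        obtain ⟨T', hT'u, hT'G⟩ := hT q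
        obtain ⟨⟨S, S', h1, h2⟩, rfl⟩ := hS
        refine ⟨S' * T', IsUnit.mul ⟨⟨S', S, h2, h1⟩, rfl⟩ hT'u, ?_⟩
        have h3 : S'ᵀ * Sᵀ = 1 := by rw [← transpose_mul, h1, transpose_one]
        have : (S' * T')ᵀ * (Sᵀ * G * S) * (S' * T') = T'ᵀ * ((S'ᵀ * Sᵀ) * G * (S * S')) * T' := by
          simp only [transpose_mul, Matrix.mul_assoc]
        simp only
        rwa [this, h3, h1, Matrix.one_mul, Matrix.mul_one]
      obtain ⟨S', hS', hS'q⟩ := ih _ hB hloc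
      refine ⟨S * S', hS.mul hS', fun q ↦ ?_⟩
      have := hS'q q
      simpa only [transpose_mul, Matrix.mul_assoc] using this
  -- A bad prime is a pole of an entry, of the determinant or of its inverse.
  have hfin : {q : HeightOneSpectrum A | ¬ IsUnimodular (q.valuation K) G}.Finite := by
    have hdet : G.det ≠ 0 := isUnit_iff_ne_zero.mp ((isUnit_iff_isUnit_det _).mp hG)
    refine ((Set.finite_iUnion fun ij : n × n ↦
      HeightOneSpectrum.Support.finite A (G ij.1 ij.2)).union
        ((HeightOneSpectrum.Support.finite A G.det).union
          (HeightOneSpectrum.Support.finite A G.det⁻¹))).subset fun q hq ↦ ?_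
    by_contra hq'
    simp only [HeightOneSpectrum.Support, Set.mem_union, Set.mem_iUnion, Set.mem_ofPred_eq,
      not_or, not_exists, not_lt, Prod.forall] at hq'
    refine hq ⟨hq'.1, le_antisymm hq'.2.1 ?_⟩
    have := hq'.2.2
    rwa [map_inv₀, inv_le_one₀ (by simpa [zero_lt_iff] using hdet)] at this
  refine key hfin.toFinset G (fun q hq ↦ ?_) h
  simpa using hq

/-- A form that is unimodular at each prime, after a change of basis depending on the prime, comes
from a unimodular form over the principal ideal domain. -/
theorem exists_cong_map_algebraMap {G : Matrix n n K} (hG : IsUnit G) (hs : G.IsSymm)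
    (h : ∀ q : HeightOneSpectrum A, ∃ T, IsUnit T ∧ IsUnimodular (q.valuation K) (Tᵀ * G * T)) :
    ∃ G' : Matrix n n A, G'.IsSymm ∧ IsUnit G' ∧ Cong G (G'.map (algebraMap A K)) := by
  obtain ⟨S, hS, hSG⟩ := exists_isUnimodular_forall hG h
  obtain ⟨⟨S, S', h1, h2⟩, rfl⟩ := hS
  have hc : Cong G (Sᵀ * G * S) := ⟨S, S', h1, h2, rfl⟩
  have hsymm := hc.isSymm hs
  simp only at hSG
  generalize Sᵀ * G * S = G₁ at hc hsymm hSG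
  choose g hg using fun i j ↦ HeightOneSpectrum.mem_integers_of_valuation_le_one K (G₁ i j)
    (fun q ↦ (hSG q).1 i j)
  have hinj : Function.Injective (algebraMap A K) := FaithfulSMul.algebraMap_injective A K
  have hg' : (of g).map (algebraMap A K) = G₁ := by
    ext i j
    exact hg i j
  subst hg'
  refine ⟨of g, ?_, ?_, hc⟩
  · ext i j
    exact hinj (hsymm.apply i j)
  · rw [isUnit_iff_isUnit_det]
    -- A nonunit determinant would lie in some maximal ideal, nonzero as the determinant is,
    -- contradicting valuation 1 there.
    by_contra hu
    obtain ⟨m, hm, hmem⟩ := exists_max_ideal_of_mem_nonunits hu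
    have hdet : (of g).det ≠ 0 := by
      intro h0
      have := (isUnit_iff_isUnit_det _).mp (hc.isUnit hG)
      rw [← RingHom.mapMatrix_apply, ← RingHom.map_det, h0, map_zero] at this
      exact not_isUnit_zero this
    have := (hSG ⟨m, hm.isPrime, fun h ↦ hdet (by simpa [h] using hmem)⟩).2
    rw [← RingHom.mapMatrix_apply, ← RingHom.map_det,
      HeightOneSpectrum.valuation_eq_one_iff_notMem] at this
    exact this hmem

end Gluing

end HasseQF

namespace HasseQF

open Matrix IsDedekindDomain

/-! ### The embedding of a field in its completion -/

section Completion

variable {K : Type*} [Field K] {v : Valuation K (WithZero (Multiplicative ℤ))}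

theorem algebraMap_completion_apply (x : K) :
    algebraMap K v.Completion x = ((WithVal.toVal v x : WithVal v) : v.Completion) := rfl

theorem valued_algebraMap_completion (x : K) :
    (Valued.v : Valuation v.Completion (WithZero (Multiplicative ℤ)))
      (algebraMap K v.Completion x) = v x := by
  rw [algebraMap_completion_apply, Valued.valuedCompletion_apply]
  rfl

theorem denseRange_algebraMap_completion : DenseRange (algebraMap K v.Completion) := by
  have h : (algebraMap K v.Completion : K → v.Completion) =
      ((↑) : WithVal v → v.Completion) ∘ WithVal.toVal v := rfl
  rw [h]
  exact UniformSpace.Completion.denseRange_coe.comp (WithVal.toVal_surjective v).denseRange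
    (UniformSpace.Completion.continuous_coe _)

end Completion

/-! ### Approximation of local data by global data -/

section Density

variable {K L : Type*} [Field K] [Field L] [Valued L (WithZero (Multiplicative ℤ))]
  {v : Valuation K (WithZero (Multiplicative ℤ))} {f : K →+* L}

theorem isOpen_valued_le_one :
    IsOpen {x : L | (Valued.v : Valuation L (WithZero (Multiplicative ℤ))) x ≤ 1} :=
  Valued.isOpen_integer L

theorem isOpen_valued_lt_one :
    IsOpen {x : L | (Valued.v : Valuation L (WithZero (Multiplicative ℤ))) x < 1} := by
  convert! Valued.isOpen_ball L 1 using 2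
  simp [Valuation.restrict_lt_one_iff]

theorem isOpen_valued_eq_one :
    IsOpen {x : L | (Valued.v : Valuation L (WithZero (Multiplicative ℤ))) x = 1} := by
  convert! Valued.isOpen_sphere L one_ne_zero using 2
  simp [Valuation.restrict_eq_one_iff]

variable {n : Type*} [Fintype n] [DecidableEq n]

theorem isOpen_isUnimodular :
    IsOpen {M : Matrix n n L |
      IsUnimodular (Valued.v : Valuation L (WithZero (Multiplicative ℤ))) M} := by
  have h : {M : Matrix n n L | IsUnimodular (Valued.v : Valuation L (WithZero (Multiplicative ℤ))) M}
      = (⋂ i, ⋂ j, (fun M : Matrix n n L ↦ M i j) ⁻¹' {x | Valued.v x ≤ 1}) ∩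
        Matrix.det ⁻¹' {x | Valued.v x = 1} := by
    ext M
    simp [IsUnimodular]
  rw [h]
  exact (isOpen_iInter_of_finite fun i ↦ isOpen_iInter_of_finite fun j ↦
    isOpen_valued_le_one.preimage (continuous_id.matrix_elem i j)).inter
    (isOpen_valued_eq_one.preimage continuous_id.matrix_det)

/-- A form over `K` that is unimodular over the completion after a change of basis is so over
`K`. -/
theorem exists_isUnimodular_of_denseRange (hf : ∀ x, Valued.v (f x) = v x) (hd : DenseRange f)
    (G : Matrix n n K) (T : Matrix n n L)
    (hT : IsUnimodular (Valued.v : Valuation L (WithZero (Multiplicative ℤ)))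
      (Tᵀ * G.map f * T)) :
    ∃ T₀ : Matrix n n K, IsUnit T₀ ∧ IsUnimodular v (T₀ᵀ * G * T₀) := by
  have hc : Continuous fun T : Matrix n n L ↦ Tᵀ * G.map f * T :=
    (continuous_id.matrix_transpose.matrix_mul continuous_const).matrix_mul continuous_id
  have hd' : DenseRange fun M : Matrix n n K ↦ M.map f :=
    DenseRange.piMap fun _ ↦ DenseRange.piMap fun _ ↦ hd
  -- Unimodularity of `Tᵀ G T` is an open condition on `T`, and matrices over `K` are dense.
  obtain ⟨T₀, hT₀⟩ := hd'.exists_mem_open (isOpen_isUnimodular.preimage hc) ⟨T, hT⟩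
  rw [Set.mem_preimage, Set.mem_ofPred_eq, ← transpose_map, ← Matrix.map_mul, ← Matrix.map_mul]
    at hT₀
  have h : IsUnimodular v (T₀ᵀ * G * T₀) := by
    refine ⟨fun i j ↦ ?_, ?_⟩
    · rw [← hf]
      exact hT₀.1 i j
    · rw [← hf, RingHom.map_det]
      exact hT₀.2
  refine ⟨T₀, ?_, h⟩
  have := h.isUnit
  rw [isUnit_iff_isUnit_det, det_mul, IsUnit.mul_iff] at this
  exact (isUnit_iff_isUnit_det _).mpr this.2

/-- An isotropic vector over the completion can be approximated by a primitive integral vector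
over `K`. -/
theorem exists_approx_isotropic (hf : ∀ x, Valued.v (f x) = v x) (hd : DenseRange f)
    {G : Matrix n n K} (h : Isotropic (G.map f)) :
    ∃ (y : n → K) (i₀ : n), (∀ i, v (y i) ≤ 1) ∧ v (y i₀) = 1 ∧ v (y ⬝ᵥ G *ᵥ y) < 1 := by
  obtain ⟨x, hx, h0⟩ := h
  obtain ⟨i₁, hi₁⟩ := Function.ne_iff.mp hx
  have : Nonempty n := ⟨i₁⟩
  obtain ⟨i₀, hi₀⟩ : ∃ i₀, ∀ j, Valued.v (x j) ≤ Valued.v (x i₀) :=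
    Finite.exists_max fun i ↦ Valued.v (x i)
  have hxi : x i₀ ≠ 0 := by
    intro h
    have := hi₀ i₁
    rw [h, map_zero, le_zero_iff, Valuation.zero_iff] at this
    exact hi₁ this
  -- The zero is scaled by a coordinate of largest valuation. The scaled vector satisfies these open
  -- conditions, and so does a nearby vector over `K`.
  let U : Set (n → L) := (⋂ i, (fun z ↦ z i) ⁻¹' {x | Valued.v x ≤ 1}) ∩
    (fun z ↦ z i₀) ⁻¹' {x | Valued.v x = 1} ∩
      (fun z ↦ z ⬝ᵥ G.map f *ᵥ z) ⁻¹' {x | Valued.v x < 1}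
  have hU : IsOpen U := by
    refine ((isOpen_iInter_of_finite fun i ↦ isOpen_valued_le_one.preimage
      (continuous_apply i)).inter (isOpen_valued_eq_one.preimage (continuous_apply i₀))).inter
        (isOpen_valued_lt_one.preimage ?_)
    exact continuous_id.dotProduct (continuous_const.matrix_mulVec continuous_id)
  have hxU : (x i₀)⁻¹ • x ∈ U := by
    refine ⟨⟨Set.mem_iInter.mpr fun i ↦ ?_, ?_⟩, ?_⟩
    · simp only [Set.mem_preimage, Set.mem_ofPred_eq, Pi.smul_apply, smul_eq_mul, map_mul, map_inv₀]
      exact inv_mul_le_one_of_le₀ (hi₀ i) zero_le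
    · simp [inv_mul_cancel₀ hxi]
    · simp [mulVec_smul, h0]
  have hd' : DenseRange fun y : n → K ↦ fun i ↦ f (y i) := DenseRange.piMap fun _ ↦ hd
  obtain ⟨y, ⟨hy1, hy2⟩, hy3⟩ := hd'.exists_mem_open hU ⟨_, hxU⟩
  refine ⟨y, i₀, fun i ↦ ?_, ?_, ?_⟩
  · rw [← hf]
    exact Set.mem_iInter.mp hy1 i
  · rw [← hf]
    exact hy2
  · rw [← hf]
    have : f (y ⬝ᵥ G *ᵥ y) = (fun i ↦ f (y i)) ⬝ᵥ G.map f *ᵥ fun i ↦ f (y i) := by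
      simp [dotProduct, mulVec]
    rw [this]
    exact hy3

end Density

/-! ### Reduction at `X = 0` -/

section Reduction

variable {k : Type*} [Field k]

open Polynomial

/-- The place `X = 0` of `k(X)`. -/
noncomputable def placeZero (k : Type*) [Field k] : HeightOneSpectrum k[X] where
  asIdeal := Ideal.span {X}
  isPrime := (Ideal.span_singleton_prime X_ne_zero).mpr prime_X
  ne_bot := by simp

variable {n : Type*} [Fintype n] [DecidableEq n]

/-- A constant form that is isotropic over the completion at `X = 0` is isotropic over `k`. -/
theorem isotropic_of_denseRange {L : Type*} [Field L] [Valued L (WithZero (Multiplicative ℤ))]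
    {f : RatFunc k →+* L} (hf : ∀ x, Valued.v (f x) = (placeZero k).valuation (RatFunc k) x)
    (hd : DenseRange f) {D : Matrix n n k}
    (h : Isotropic ((D.map (algebraMap k (RatFunc k))).map f)) : Isotropic D := by
  obtain ⟨y, i₀, hy, hy₀, hval⟩ := exists_approx_isotropic hf hd h
  choose c d hcd using fun i ↦ (placeZero k).exists_primeCompl_mul_eq_of_integer (y i) (hy i)
  -- Multiply the approximate zero by a common denominator that does not vanish at 0. Evaluation at
  -- 0 then gives a nonzero vector over `k`, and it is a zero of `D` because `D` is constant.
  let e : n → k[X] := fun i ↦ c i * ∏ j ∈ Finset.univ.erase i, (d j : k[X])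
  have he (i : n) : algebraMap k[X] (RatFunc k) (e i) =
      algebraMap k[X] (RatFunc k) (∏ j, (d j : k[X])) * y i := by
    rw [map_mul, ← hcd, ← Finset.mul_prod_erase _ _ (Finset.mem_univ i), map_mul]
    ring
  have hmem (p : k[X]) : p ∈ (placeZero k).asIdeal ↔ p.eval 0 = 0 := by
    rw [← coeff_zero_eq_eval_zero, ← X_dvd_iff]
    exact Ideal.mem_span_singleton
  have hd : (placeZero k).valuation (RatFunc k)
      (algebraMap k[X] (RatFunc k) (∏ j, (d j : k[X]))) = 1 := by
    rw [map_prod, map_prod]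
    exact Finset.prod_eq_one fun j _ ↦ (HeightOneSpectrum.valuation_eq_one_iff_notMem _).mpr (d j).2
  refine ⟨fun i ↦ (e i).eval 0, fun h0 ↦ ?_, ?_⟩
  · have h1 : (placeZero k).valuation (RatFunc k) (algebraMap k[X] (RatFunc k) (e i₀)) = 1 := by
      rw [he, map_mul, hd, hy₀, one_mul]
    rw [HeightOneSpectrum.valuation_eq_one_iff_notMem, hmem] at h1
    exact h1 (congrFun h0 i₀)
  · have h1 : (fun i ↦ (e i).eval 0) ⬝ᵥ D *ᵥ (fun i ↦ (e i).eval 0) =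
        (e ⬝ᵥ D.map C *ᵥ e).eval 0 := by
      simp [dotProduct, mulVec, eval_finsetSum]
    rw [h1, ← hmem, ← HeightOneSpectrum.valuation_lt_one_iff_mem (K := RatFunc k)]
    have h2 : algebraMap k[X] (RatFunc k) (e ⬝ᵥ D.map C *ᵥ e) =
        algebraMap k[X] (RatFunc k) (∏ j, (d j : k[X])) ^ 2 *
          (y ⬝ᵥ D.map (algebraMap k (RatFunc k)) *ᵥ y) := by
      simp only [dotProduct, mulVec, map_sum, map_mul, he, Matrix.map_apply, Finset.mul_sum,
        RatFunc.algebraMap_C, ← RatFunc.algebraMap_eq_C]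
      refine Finset.sum_congr rfl fun i _ ↦ Finset.sum_congr rfl fun j _ ↦ ?_
      ring
    refine (congrArg _ h2).trans_lt ?_
    rwa [map_mul, map_pow, hd, one_pow, one_mul]

end Reduction

end HasseQF

namespace HasseQF

open Matrix IsDedekindDomain Polynomial

/-! ### Descent of hyperbolicity and subforms of hyperbolic forms -/

section Descent

theorem hyp_eq_diagonal (R : Type*) [CommRing R] (n : ℕ) :
    hyp R n = diagonal (Sum.elim (fun _ : Fin n ↦ (1 : R)) (fun _ ↦ -1)) := by
  rw [← dsum_diagonal, hyp, ← diagonal_one, diagonal_neg]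

theorem card_of_cong_hyp {R : Type*} [CommRing R] [Nontrivial R] {n : Type*} [Fintype n]
    [DecidableEq n] {G : Matrix n n R} {m : ℕ} (h : Cong G (hyp R m)) :
    Fintype.card n = 2 * m := by
  have := h.card_eq
  rw [Fintype.card_sum, Fintype.card_fin] at this
  omega

theorem cong_hyp_succ (R : Type*) [CommRing R] [Nontrivial R] (m : ℕ) :
    Cong (hyp R (m + 1)) (dsum (hyp R 1) (hyp R m)) := by
  obtain ⟨n, hn⟩ := IsHyp.add (⟨1, Cong.refl _⟩ : IsHyp (hyp R 1)) ⟨m, Cong.refl (hyp R m)⟩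
  have := card_of_cong_hyp hn
  simp only [Fintype.card_sum, Fintype.card_fin] at this
  obtain rfl : n = m + 1 := by omega
  exact hn.symm

theorem isotropic_hyp_succ (R : Type*) [CommRing R] [Nontrivial R] (m : ℕ) :
    Isotropic (hyp R (m + 1)) := by
  refine ⟨Sum.elim (Pi.single 0 1) (Pi.single 0 1), fun h ↦ ?_, ?_⟩
  · have := congrFun h (Sum.inl 0)
    simp at this
  · simp [fromBlocks_mulVec]

/-- If isotropy descends along a field extension, then so does hyperbolicity. -/
theorem isHyp_of_map {k L : Type*} [Field k] [Field L] [Invertible (2 : k)] (f : k →+* L)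
    (hf : ∀ (n : ℕ) (D : Matrix (Fin n) (Fin n) k), Isotropic (D.map f) → Isotropic D)
    {n : ℕ} {D : Matrix (Fin n) (Fin n) k} (hs : D.IsSymm) (hu : IsUnit D)
    (h : IsHyp (D.map f)) : IsHyp D := by
  have h2 : (2 : L) ≠ 0 := by
    have := (map_ne_zero f).mpr (Invertible.ne_zero (2 : k))
    rwa [map_ofNat] at this
  induction n using Nat.strong_induction_on with
  | _ n ih =>
    obtain ⟨m, hm⟩ := h
    obtain _ | m := m
    · have hn := card_of_cong_hyp hm
      rw [Fintype.card_fin] at hn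
      subst hn
      refine ⟨0, ?_⟩
      have := cong_submatrix D (Equiv.equivOfIsEmpty (Fin 0 ⊕ Fin 0) (Fin 0))
      rwa [Subsingleton.elim (D.submatrix _ _) (hyp k 0)] at this
    -- A hyperbolic plane splits off over `k`. Witt cancellation over `L` shows that the complement
    -- is still hyperbolic there, and it is smaller.
    · obtain ⟨n', D', hD'⟩ :=
        (hf n D (hm.isotropic (isotropic_hyp_succ L m))).exists_cong_dsum_hyp hs hu
      have hn := hD'.card_eq
      simp only [Fintype.card_sum, Fintype.card_fin] at hn
      have hs' := ((isSymm_dsum_iff _ _).mp (hD'.isSymm hs)).2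
      have h1 := hD'.map f
      rw [map_dsum, map_hyp] at h1
      have h3 := (h1.symm.trans hm).trans (cong_hyp_succ L m)
      rw [hyp_eq_diagonal L 1] at h3
      have h4 := h3.cancel_diagonal h2 (by rintro (i | i) <;> simp) (hs'.map f)
      exact IsHyp.congr (IsHyp.add ⟨1, Cong.refl _⟩ (ih n' (by omega) hs'
        ((isUnit_dsum_iff _ _).mp (hD'.isUnit hu)).2 ⟨m, h4⟩)) hD'

/-- A subform of a hyperbolic form of more than half the dimension is isotropic. -/
theorem isotropic_of_isHyp_dsum {F : Type*} [Field F] {m n : Type*} [Fintype m] [Fintype n]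
    [DecidableEq m] [DecidableEq n] {B : Matrix m m F} {N : Matrix n n F} (h : IsHyp (dsum B N))
    (hc : Fintype.card (m ⊕ n) < 2 * Fintype.card m) : Isotropic B := by
  obtain ⟨d, hd⟩ := h
  rw [card_of_cong_hyp hd] at hc
  obtain ⟨P, P', h1, h2, hP⟩ := hd.symm
  -- In hyperbolic coordinates, the vectors whose two halves agree form a totally isotropic
  -- subspace. It is cut out by `d` equations, fewer than `card m`, so it meets the space of `B`
  -- nontrivially.
  let g : (m → F) →ₗ[F] (Fin d → F) := (P.toRows₁ - P.toRows₂).mulVecLin ∘ₗ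
    (fromRows (1 : Matrix m m F) (0 : Matrix n m F)).mulVecLin
  have hker : LinearMap.ker g ≠ ⊥ := by
    refine LinearMap.ker_ne_bot_of_finrank_lt ?_
    simpa using hc
  obtain ⟨x, hx, hx0⟩ := Submodule.exists_mem_ne_zero_of_ne_bot hker
  refine ⟨x, hx0, ?_⟩
  have hv : fromRows (1 : Matrix m m F) (0 : Matrix n m F) *ᵥ x = Sum.elim x 0 := by
    rw [fromRows_mulVec, one_mulVec, zero_mulVec]
  have h3 : P.toRows₁ *ᵥ Sum.elim x 0 = P.toRows₂ *ᵥ Sum.elim x 0 := by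
    have : (P.toRows₁ - P.toRows₂) *ᵥ
      (fromRows (1 : Matrix m m F) (0 : Matrix n m F) *ᵥ x) = 0 := hx
    rwa [hv, sub_mulVec, sub_eq_zero] at this
  have h4 : P *ᵥ Sum.elim x 0 = Sum.elim (P.toRows₂ *ᵥ Sum.elim x 0) (P.toRows₂ *ᵥ Sum.elim x 0) := by
    nth_rewrite 1 [← fromRows_toRows P]
    rw [fromRows_mulVec, h3]
  have h5 : Sum.elim x (0 : n → F) ⬝ᵥ dsum B N *ᵥ Sum.elim x 0 = 0 := by
    rw [← hP, dotProduct_cong_mulVec, h4, sumElim_dotProduct_dsum]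
    simp [neg_mulVec]
  rw [sumElim_dotProduct_dsum] at h5
  simpa using h5

end Descent

/-! ### The local-global principle in matrix form -/

section Core

variable {k : Type*} [Field k]

theorem valuation_mem_valuationsTrivialOn (q : HeightOneSpectrum k[X]) :
    q.valuation (RatFunc k) ∈ valuationsTrivialOn k := by
  refine ⟨inferInstance, ⟨fun a ha ↦ ?_⟩⟩
  rw [IsScalarTower.algebraMap_apply k k[X] (RatFunc k)]
  exact valuation_algebraMap_isUnit q (ha.isUnit.map (algebraMap k k[X]))

/-- The hyperbolic form is diagonal with entries `1` and `-1`, so a local hyperbolic basis spans a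
unimodular lattice; density moves it to `K`. Reindexing makes the base change square. -/
theorem exists_isUnimodular_of_isHyp {n : Type*} [Fintype n] [DecidableEq n] {K : Type*} [Field K]
    {v : Valuation K (WithZero (Multiplicative ℤ))} {G : Matrix n n K}
    (h : IsHyp (G.map (algebraMap K v.Completion))) :
    ∃ T : Matrix n n K, IsUnit T ∧ IsUnimodular v (Tᵀ * G * T) := by
  obtain ⟨m, hm⟩ := h
  have e : n ≃ Fin m ⊕ Fin m := Fintype.equivOfCardEq hm.card_eq
  obtain ⟨P, P', h1, h2, hP⟩ := hm
  refine exists_isUnimodular_of_denseRange (L := v.Completion) (f := algebraMap K v.Completion)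
    valued_algebraMap_completion denseRange_algebraMap_completion G (P.submatrix id e) ?_
  have h3 : (P.submatrix id e)ᵀ * G.map (algebraMap K v.Completion) * P.submatrix id e =
      (hyp v.Completion m).submatrix e e := by
    rw [← hP]
    ext i j
    simp [Matrix.mul_apply]
  rw [h3]
  have h4 : IsUnimodular (Valued.v : Valuation v.Completion (WithZero (Multiplicative ℤ)))
      (hyp v.Completion m) := by
    rw [hyp_eq_diagonal]
    refine isUnimodular_diagonal ?_
    rintro (i | i)
    · simp
    · simp [Valuation.map_neg]
  refine ⟨fun i j ↦ h4.1 _ _, ?_⟩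
  rw [det_submatrix_equiv_self]
  exact h4.2

/-- A regular form over `k(X)` that is hyperbolic over all completions is hyperbolic. -/
theorem isHyp_of_completions [NeZero (2 : k)] {n : Type*} [Fintype n] [DecidableEq n]
    {G : Matrix n n (RatFunc k)} (hs : G.IsSymm) (hu : IsUnit G)
    (h : ∀ q : HeightOneSpectrum k[X],
      IsHyp (G.map (algebraMap (RatFunc k) (q.valuation (RatFunc k)).Completion))) :
    IsHyp G := by
  have h2 : (2 : k) ≠ 0 := NeZero.ne 2
  let := invertibleOfNonzero h2
  obtain ⟨G', hs', hu', hG'⟩ :=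
    exists_cong_map_algebraMap hu hs fun q ↦ exists_isUnimodular_of_isHyp (h q)
  obtain ⟨m, D, hD⟩ := exists_cong_map_C h2 hs' hu'
  have hGD : Cong G (D.map (algebraMap k (RatFunc k))) := by
    have := hG'.trans (hD.map (algebraMap k[X] (RatFunc k)))
    rwa [Matrix.map_map] at this
  have hDu : IsUnit D := by
    have := (isUnit_iff_isUnit_det _).mp (hGD.isUnit hu)
    rw [← RingHom.mapMatrix_apply, ← RingHom.map_det] at this
    rw [isUnit_iff_isUnit_det, isUnit_iff_ne_zero]
    exact fun h0 ↦ this.ne_zero (by rw [h0, map_zero])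
  have hDs : D.IsSymm := by
    have := hGD.isSymm hs
    ext i j : 1
    exact (algebraMap k (RatFunc k)).injective (this.apply i j)
  have hDhyp : IsHyp D := by
    -- A single completion suffices for the constant form: the place `X = 0` has residue field `k`.
    refine isHyp_of_map ((algebraMap (RatFunc k)
      ((placeZero k).valuation (RatFunc k)).Completion).comp (algebraMap k (RatFunc k)))
      (fun n D hD ↦ ?_) hDs hDu ?_
    · rw [RingHom.coe_comp, ← Matrix.map_map] at hD
      exact isotropic_of_denseRange
        (L := ((placeZero k).valuation (RatFunc k)).Completion)
        (f := algebraMap (RatFunc k) ((placeZero k).valuation (RatFunc k)).Completion)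
        valued_algebraMap_completion denseRange_algebraMap_completion hD
    · rw [RingHom.coe_comp, ← Matrix.map_map]
      exact (h (placeZero k)).congr (hGD.symm.map _)
  exact (hDhyp.map (algebraMap k (RatFunc k))).congr hGD

/-- The Hasse principle for isometry, for diagonal forms. -/
theorem cong_diagonal_of_completions [NeZero (2 : k)] {m n : ℕ} {w : Fin m → RatFunc k}
    {w' : Fin n → RatFunc k} (hw : ∀ i, w i ≠ 0) (hw' : ∀ i, w' i ≠ 0)
    (h : ∀ q : HeightOneSpectrum k[X],
      Cong ((diagonal w).map (algebraMap (RatFunc k) (q.valuation (RatFunc k)).Completion))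
        ((diagonal w').map (algebraMap (RatFunc k) (q.valuation (RatFunc k)).Completion))) :
    Cong (diagonal w) (diagonal w') := by
  have hmn : m = n := by simpa using (h (placeZero k)).card_eq
  subst hmn
  -- Locally `w ⊥ -w'` is isometric to the hyperbolic form `w' ⊥ -w'`. Once this holds globally,
  -- cancelling `-w'` leaves the claim.
  have hhyp' : IsHyp (dsum (diagonal w') (-diagonal w')) :=
    isHyp_dsum_neg (diagonal_transpose _) (isUnit_diagonal hw')
  have hhyp : IsHyp (dsum (diagonal w) (-diagonal w')) := by
    refine isHyp_of_completions
      ((isSymm_dsum_iff _ _).mpr ⟨diagonal_transpose _, by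
        rw [diagonal_neg]; exact diagonal_transpose _⟩)
      ((isUnit_dsum_iff _ _).mpr ⟨isUnit_diagonal hw, (isUnit_diagonal hw').neg⟩) fun q ↦ ?_
    have := hhyp'.map (algebraMap (RatFunc k) (q.valuation (RatFunc k)).Completion)
    rw [map_dsum] at this ⊢
    exact this.congr ((h q).add (Cong.refl _))
  obtain ⟨a, ha⟩ := hhyp
  obtain ⟨b, hb⟩ := hhyp'
  obtain rfl : a = b := by
    have h1 := card_of_cong_hyp ha
    have h2 := card_of_cong_hyp hb
    omega
  have h3 := (cong_dsum_comm _ _).trans ((ha.trans hb.symm).trans (cong_dsum_comm _ _))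
  rw [diagonal_neg] at h3
  exact h3.cancel_diagonal (Invertible.ne_zero _) (fun i ↦ neg_ne_zero.mpr (hw' i))
    (diagonal_transpose _)

/-- The Hasse principle for isotropy for diagonal Pfister neighbors. -/
theorem isotropic_of_completions [NeZero (2 : k)] {m n : Type*} [Fintype m] [DecidableEq m]
    [Fintype n] [DecidableEq n] {l : List (RatFunc k)} (hl : ∀ a ∈ l, a ≠ 0) {c : RatFunc k}
    (hc : c ≠ 0) {B : Matrix m m (RatFunc k)} {N : Matrix n n (RatFunc k)}
    (hB : Cong (pfisterMatrix l) (dsum (c • B) N))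
    (hcard : Fintype.card (PIdx l) < 2 * Fintype.card m)
    (h : ∀ q : HeightOneSpectrum k[X], Isotropic
      (B.map (algebraMap (RatFunc k) (q.valuation (RatFunc k)).Completion))) :
    Isotropic B := by
  -- The Pfister form contains `c • B`, so it is locally isotropic and therefore locally hyperbolic.
  have hM : IsHyp (pfisterMatrix l) := by
    refine isHyp_of_completions (isSymm_pfisterMatrix l) (isUnit_pfisterMatrix hl) fun q ↦ ?_
    have hiso : Isotropic (pfisterMatrix (l.map
        (algebraMap (RatFunc k) (q.valuation (RatFunc k)).Completion))) := by
      have h1 := hB.map (algebraMap (RatFunc k) (q.valuation (RatFunc k)).Completion)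
      rw [map_dsum, show (c • B).map (algebraMap (RatFunc k) (q.valuation (RatFunc k)).Completion) =
        algebraMap (RatFunc k) (q.valuation (RatFunc k)).Completion c •
          B.map (algebraMap (RatFunc k) (q.valuation (RatFunc k)).Completion) by
            ext i j; simp] at h1
      exact (cong_map_pfisterMatrix _ l).symm.isotropic
        (h1.isotropic (((h q).smul _).dsum_left _))
    let : Invertible (2 : (q.valuation (RatFunc k)).Completion) :=
      (Invertible.map (algebraMap (RatFunc k) (q.valuation (RatFunc k)).Completion) 2).copy 2
        (map_ofNat _ _).symm
    refine (isHyp_pfisterMatrix_of_isotropic (fun a ha ↦ ?_) hiso).congr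
      (cong_map_pfisterMatrix _ l)
    obtain ⟨b, hb, rfl⟩ := List.mem_map.mp ha
    exact (_root_.map_ne_zero _).mpr (hl b hb)
  have hiso : Isotropic (c • B) := by
    refine isotropic_of_isHyp_dsum (hM.congr hB.symm) ?_
    rwa [← hB.card_eq]
  have := hiso.smul c⁻¹
  rwa [smul_smul, inv_mul_cancel₀ hc, one_smul] at this

end Core

end HasseQF

namespace HasseQF

open Matrix Module QuadraticMap IsDedekindDomain Polynomial

/-! ### From quadratic forms to Gram matrices -/

section Gram

variable {F : Type*} [Field F] [Invertible (2 : F)] {E E' : Type*} [AddCommGroup E] [Module F E]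
  [AddCommGroup E'] [Module F E'] {m n : Type*} [Fintype m] [DecidableEq m] [Fintype n]
  [DecidableEq n]

/-- `M` is a Gram matrix of the quadratic form `Q`. -/
def IsGram (Q : QuadraticForm F E) (M : Matrix n n F) : Prop :=
  ∃ b : Basis n F E, Q.toMatrix b = M

theorem toMatrix_apply_eq (Q : QuadraticForm F E) (b : Basis n F E) (i j : n) :
    Q.toMatrix b i j = associated Q (b i) (b j) :=
  LinearMap.toMatrix₂_apply _ _ _ _ _

theorem apply_eq_dotProduct (Q : QuadraticForm F E) (b : Basis n F E) (x : E) :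
    Q x = b.equivFun x ⬝ᵥ Q.toMatrix b *ᵥ b.equivFun x := by
  rw [← associated_eq_self_apply F Q x]
  exact apply_eq_dotProduct_toMatrix₂_mulVec b b _ x x

theorem IsGram.card_eq {Q : QuadraticForm F E} {M : Matrix n n F} (h : IsGram Q M) :
    Fintype.card n = finrank F E :=
  (finrank_eq_card_basis h.choose).symm

theorem IsGram.isIsotropic_iff {Q : QuadraticForm F E} {M : Matrix n n F} (h : IsGram Q M) :
    IsIsotropic Q ↔ Isotropic M := by
  obtain ⟨b, rfl⟩ := h
  constructor
  · rintro ⟨x, hx, h⟩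
    exact ⟨b.equivFun x, by simpa using hx, by rw [← apply_eq_dotProduct, h]⟩
  · rintro ⟨x, hx, h⟩
    exact ⟨b.equivFun.symm x, (LinearEquiv.map_ne_zero_iff _).mpr hx, by
      rw [apply_eq_dotProduct Q b, LinearEquiv.apply_symm_apply, h]⟩

theorem IsGram.cong {Q : QuadraticForm F E} {M : Matrix m m F} {N : Matrix n n F}
    (hM : IsGram Q M) (hN : IsGram Q N) : Cong M N := by
  obtain ⟨b, rfl⟩ := hM
  obtain ⟨c, rfl⟩ := hN
  exact ⟨b.toMatrix c, c.toMatrix b, b.toMatrix_mul_toMatrix_flip c, c.toMatrix_mul_toMatrix_flip b,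
    LinearMap.toMatrix₂_mul_basis_toMatrix b b c c _⟩

theorem IsGram.of_equivalent {Q : QuadraticForm F E} {Q' : QuadraticForm F E'} {M : Matrix n n F}
    (h : IsGram Q M) (hQ : Q.Equivalent Q') : IsGram Q' M := by
  obtain ⟨b, rfl⟩ := h
  obtain ⟨e⟩ := hQ
  refine ⟨b.map e.toLinearEquiv, ?_⟩
  ext i j
  simp only [toMatrix_apply_eq, associated_apply, Basis.map_apply]
  have h1 (x : E) : Q' (e.toLinearEquiv x) = Q x := e.map_app x
  rw [← map_add, h1, h1, h1]

theorem IsGram.equivalent {Q : QuadraticForm F E} {Q' : QuadraticForm F E'} {M : Matrix m m F}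
    {N : Matrix n n F} (h : IsGram Q M) (h' : IsGram Q' N) (hMN : Cong M N) : Q.Equivalent Q' := by
  obtain ⟨b, rfl⟩ := h
  obtain ⟨c, rfl⟩ := h'
  obtain ⟨P, P', h1, h2, hP⟩ := hMN
  let e : (n → F) ≃ₗ[F] (m → F) := Matrix.toLin'OfInv h2 h1
  refine Equivalent.symm ⟨⟨(c.equivFun.trans e).trans b.equivFun.symm, fun x ↦ ?_⟩⟩
  change Q (b.equivFun.symm (P *ᵥ c.equivFun x)) = Q' x
  rw [apply_eq_dotProduct Q b, LinearEquiv.apply_symm_apply, apply_eq_dotProduct Q' c, ← hP,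
    dotProduct_cong_mulVec]

theorem IsGram.prod {Q : QuadraticForm F E} {Q' : QuadraticForm F E'} {M : Matrix m m F}
    {N : Matrix n n F} (h : IsGram Q M) (h' : IsGram Q' N) : IsGram (Q.prod Q') (dsum M N) := by
  obtain ⟨b, rfl⟩ := h
  obtain ⟨c, rfl⟩ := h'
  refine ⟨b.prod c, ?_⟩
  ext (i | i) (j | j) <;> simp [toMatrix_apply_eq]

theorem IsGram.smul {Q : QuadraticForm F E} {M : Matrix n n F} (h : IsGram Q M) (a : F) :
    IsGram (a • Q) (a • M) := by
  obtain ⟨b, rfl⟩ := h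
  exact ⟨b, QuadraticForm.toMatrix_smul b a Q⟩

theorem IsGram.baseChange {L : Type*} [Field L] [Algebra F L] [Invertible (2 : L)]
    {Q : QuadraticForm F E} {M : Matrix n n F} (h : IsGram Q M) :
    IsGram (Q.baseChange L) (M.map (algebraMap F L)) := by
  obtain ⟨b, rfl⟩ := h
  refine ⟨b.baseChange L, ?_⟩
  ext i j
  rw [toMatrix_apply_eq, QuadraticForm.associated_baseChange, Basis.baseChange_apply,
    Basis.baseChange_apply, LinearMap.BilinForm.baseChange_tmul, map_apply, toMatrix_apply_eq]
  simp [Algebra.algebraMap_eq_smul_one]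

theorem IsGram.tmul {Q : QuadraticForm F E} {Q' : QuadraticForm F E'} {M : Matrix m m F}
    {N : Matrix n n F} (h : IsGram Q M) (h' : IsGram Q' N) :
    IsGram (Q.tmul Q') (kroneckerMap (· * ·) M N) := by
  obtain ⟨b, rfl⟩ := h
  obtain ⟨c, rfl⟩ := h'
  refine ⟨b.tensorProduct c, ?_⟩
  ext ⟨i, i'⟩ ⟨j, j'⟩
  rw [toMatrix_apply_eq, QuadraticForm.associated_tmul, Basis.tensorProduct_apply,
    Basis.tensorProduct_apply, LinearMap.BilinForm.tensorDistrib_tmul, kroneckerMap_apply,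
    toMatrix_apply_eq, toMatrix_apply_eq, smul_eq_mul, mul_comm]

theorem isGram_weightedSumSquares (w : n → F) :
    IsGram (weightedSumSquares F w) (diagonal w) := by
  refine ⟨Pi.basisFun F n, ?_⟩
  ext i j
  rw [toMatrix_apply_eq, diagonal_apply, Pi.basisFun_apply, Pi.basisFun_apply]
  split_ifs with hij
  · rw [hij, associated_eq_self_apply]
    simp [weightedSumSquares_apply, Pi.single_apply]
  · rw [associated_apply, invOf_smul_eq_iff, smul_zero, weightedSumSquares_apply,
      weightedSumSquares_apply, weightedSumSquares_apply, ← Finset.sum_sub_distrib,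
      ← Finset.sum_sub_distrib]
    refine Finset.sum_eq_zero fun l _ ↦ ?_
    by_cases hl : l = i
    · subst hl
      simp [hij]
    · simp [hl]

theorem isGram_tmul_binary {Q : QuadraticForm F E} {M : Matrix n n F} (h : IsGram Q M) (a : F) :
    ∃ N : Matrix (Fin 2 × n) (Fin 2 × n) F, Cong (dsum M (a • M)) N ∧
      IsGram (QuadraticForm.tmul (weightedSumSquares F ![1, a]) Q) N := by
  refine ⟨_, ?_, (isGram_weightedSumSquares _).tmul h⟩
  let e : Fin 2 × n ≃ n ⊕ n := (Equiv.prodCongr finTwoEquiv (Equiv.refl n)).trans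
    (Equiv.boolProdEquivSum n)
  convert cong_submatrix (dsum M (a • M)) e
  ext ⟨i, i'⟩ ⟨j, j'⟩
  fin_cases i <;> fin_cases j <;> simp [e, finTwoEquiv]

theorem isGram_sq : IsGram (sq : QuadraticForm F F) (1 : Matrix Unit Unit F) := by
  refine ⟨Basis.singleton Unit F, ?_⟩
  ext i j
  simp [toMatrix_apply_eq]

/-- The entries are the values of `Q` on an orthogonal basis. The dimension is a separate variable
`d` so that low-dimensional forms are indexed by literal `Fin 2`, `Fin 3` and `Fin 4`. -/
theorem exists_isGram_diagonal [FiniteDimensional F E] (Q : QuadraticForm F E) {d : ℕ}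
    (hd : finrank F E = d) : ∃ w : Fin d → F, IsGram Q (diagonal w) ∧ (IsRegular Q → ∀ i, w i ≠ 0) := by
  subst hd
  obtain ⟨b, hb⟩ := LinearMap.BilinForm.exists_orthogonal_basis (QuadraticForm.associated_isSymm F Q)
  refine ⟨fun i ↦ Q (b i), ⟨b, ?_⟩, fun hQ i ↦ ?_⟩
  · ext i j
    rw [toMatrix_apply_eq, diagonal_apply]
    split_ifs with hij
    · rw [hij, associated_eq_self_apply]
    · exact hb hij
  · have := hb.not_isOrtho_basis_self_of_separatingLeft
      ((nondegenerate_associated_iff (Q := Q)).mpr hQ).1 i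
    rwa [associated_eq_self_apply] at this

/-- The index type is existential because each tensor factor produces a Kronecker product, which is
only congruent to the recursive block sum defining `pfisterMatrix`. -/
theorem exists_isGram_pfister {F : Type u} [Field F] [Invertible (2 : F)] (l : List Fˣ) :
    ∃ (ι : Type) (_ : Fintype ι) (_ : DecidableEq ι) (M : Matrix ι ι F),
      Cong (pfisterMatrix (l.map ((↑) : Fˣ → F))) M ∧ IsGram (pfister l).form M := by
  induction l with
  | nil => exact ⟨_, _, _, _, cong_pfisterMatrix_nil, isGram_sq⟩
  | cons a l ih =>
    obtain ⟨ι, _, _, M, hM, h⟩ := ih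
    obtain ⟨N, hN, h'⟩ := isGram_tmul_binary h (a : F)
    exact ⟨_, _, _, N, (cong_pfisterMatrix_cons _ _).trans ((hM.add (hM.smul _)).trans hN), h'⟩

end Gram

end HasseQF

namespace HasseQF

open Matrix Module IsDedekindDomain Polynomial

/-! ### Forms of dimension 2, 3 and 4 as Pfister forms and neighbors -/

section LowDimension

variable {F : Type*} [Field F]

theorem cong_pfisterMatrix_singleton (a : F) : Cong (pfisterMatrix [a]) (diagonal ![1, a]) := by
  let f : Fin 2 → Unit ⊕ Unit := ![.inl (), .inr ()]
  have hf : Function.Bijective f := by decide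
  let e : Fin 2 ≃ PIdx [a] := Equiv.ofBijective f hf
  have h := cong_diagonal_comp (pfisterWeight [a]) e
  have h1 : pfisterWeight [a] ∘ e = ![1, a] := by
    funext i
    fin_cases i
    exacts [rfl, mul_one a]
  rwa [h1] at h

theorem cong_pfisterMatrix_pair (a b : F) :
    Cong (pfisterMatrix [a, b]) (diagonal ![1, b, a, a * b]) := by
  let f : Fin 4 → (Unit ⊕ Unit) ⊕ (Unit ⊕ Unit) :=
    ![.inl (.inl ()), .inl (.inr ()), .inr (.inl ()), .inr (.inr ())]
  have hf : Function.Bijective f := by decide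
  let e : Fin 4 ≃ PIdx [a, b] := Equiv.ofBijective f hf
  have h := cong_diagonal_comp (pfisterWeight [a, b]) e
  have h1 : pfisterWeight [a, b] ∘ e = ![1, b, a, a * b] := by
    funext i
    fin_cases i
    exacts [rfl, mul_one b, mul_one a, congrArg (a * ·) (mul_one b)]
  rwa [h1] at h

theorem cong_pfisterMatrix_binary {w : Fin 2 → F} (hw : ∀ i, w i ≠ 0) :
    Cong (pfisterMatrix [w 0 * w 1]) (w 0 • diagonal w) := by
  refine (cong_pfisterMatrix_singleton _).trans ?_
  rw [← diagonal_smul]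
  refine cong_diagonal_of_eq_mul_sq _ _ ![w 0, 1] (fun i ↦ ?_) fun i ↦ ?_
  · fin_cases i <;> simp [hw]
  · fin_cases i <;> simp [← sq]

/-- Scaling by `w 0` gives `⟨1, w₀w₁, w₀w₂⟩` up to squares; the fourth Pfister entry `w₀²w₁w₂` is
`w₁w₂` up to a square. -/
theorem cong_pfisterMatrix_ternary {w : Fin 3 → F} (hw : ∀ i, w i ≠ 0) :
    Cong (pfisterMatrix [w 0 * w 2, w 0 * w 1])
      (dsum (w 0 • diagonal w) (diagonal fun _ : Fin 1 ↦ w 1 * w 2)) := by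
  refine (cong_pfisterMatrix_pair _ _).trans ((cong_diagonal_comp _ finSumFinEquiv).trans ?_)
  rw [← diagonal_smul, dsum_diagonal]
  have h0 := hw 0
  refine cong_diagonal_of_eq_mul_sq _ _ (Sum.elim ![w 0, 1, 1] fun _ ↦ (w 0)⁻¹) (fun i ↦ ?_)
    fun i ↦ ?_
  · rcases i with i | i <;> fin_cases i <;> simp [hw]
  · rcases i with i | i <;> fin_cases i
    · change w 0 * w 0 = 1 * w 0 ^ 2
      ring
    · change w 0 * w 1 = w 0 * w 1 * 1 ^ 2
      ring
    · change w 0 * w 2 = w 0 * w 2 * 1 ^ 2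
      ring
    · change w 1 * w 2 = w 0 * w 2 * (w 0 * w 1) * (w 0)⁻¹ ^ 2
      field_simp

/-- Trivial determinant makes `w₀w₃` equal to `w₁w₂` up to a square, so the fourth Pfister entry
belongs to the scaled form itself. -/
theorem cong_pfisterMatrix_quaternary {w : Fin 4 → F} (hw : ∀ i, w i ≠ 0) {s : F}
    (hs : w 0 * w 1 * w 2 * w 3 = s ^ 2) :
    Cong (pfisterMatrix [w 0 * w 2, w 0 * w 1]) (w 0 • diagonal w) := by
  refine (cong_pfisterMatrix_pair _ _).trans ?_
  rw [← diagonal_smul]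
  have h0 := hw 0
  have h1 := hw 1
  have h2 := hw 2
  have h3 := hw 3
  have hs0 : s ≠ 0 := by
    rintro rfl
    simp [hw] at hs
  refine cong_diagonal_of_eq_mul_sq _ _ ![w 0, 1, 1, s / (w 0 * w 1 * w 2)] (fun i ↦ ?_)
    fun i ↦ ?_
  · fin_cases i <;> simp [hw, hs0]
  · fin_cases i <;> simp [← sq]
    field_simp
    linear_combination hs

end LowDimension

/-! ### Assembly of the Hasse principles -/

section Main

variable {k : Type u} [Field k] [NeZero (2 : k)] {E : Type v} [AddCommGroup E]
  [Module (RatFunc k) E]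

theorem invertible_two_completion (q : HeightOneSpectrum k[X]) :
    Nonempty (Invertible (2 : (q.valuation (RatFunc k)).Completion)) :=
  ⟨(Invertible.map (algebraMap (RatFunc k) (q.valuation (RatFunc k)).Completion) 2).copy 2
    (map_ofNat _ _).symm⟩

theorem hasseIsotropy_of_cong {m n : Type*} [Fintype m] [DecidableEq m] [Fintype n]
    [DecidableEq n] {Q : QuadraticForm (RatFunc k) E} {B : Matrix m m (RatFunc k)}
    (hQ : IsGram Q B) {l : List (RatFunc k)} (hl : ∀ a ∈ l, a ≠ 0) {c : RatFunc k} (hc : c ≠ 0)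
    {N : Matrix n n (RatFunc k)} (hB : Cong (pfisterMatrix l) (dsum (c • B) N))
    (hcard : Fintype.card (PIdx l) < 2 * Fintype.card m) :
    HasseIsotropy (valuationsTrivialOn k) Q := by
  intro h
  refine hQ.isIsotropic_iff.mpr (isotropic_of_completions hl hc hB hcard fun q ↦ ?_)
  obtain ⟨_⟩ := invertible_two_completion q
  exact hQ.baseChange.isIsotropic_iff.mp (h _ (valuation_mem_valuationsTrivialOn q))

/-- A form similar to a Pfister form satisfies the Hasse principle for isotropy. -/
theorem hasseIsotropy_of_cong_smul {m : Type*} [Fintype m] [DecidableEq m]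
    {Q : QuadraticForm (RatFunc k) E} {B : Matrix m m (RatFunc k)} (hQ : IsGram Q B)
    {l : List (RatFunc k)} (hl : ∀ a ∈ l, a ≠ 0) {c : RatFunc k} (hc : c ≠ 0)
    (hB : Cong (pfisterMatrix l) (c • B)) (hm : 0 < Fintype.card m) :
    HasseIsotropy (valuationsTrivialOn k) Q := by
  -- A form similar to a Pfister form is a neighbor with empty complement; positive dimension makes
  -- the dimension inequality strict.
  refine hasseIsotropy_of_cong (N := (0 : Matrix (Fin 0) (Fin 0) (RatFunc k))) hQ hl hc
    (hB.trans (cong_dsum_empty _ _)) ?_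
  rw [hB.card_eq]
  omega

theorem forall_mem_map_coe_ne_zero {F : Type*} [Field F] (l : List Fˣ) :
    ∀ a ∈ l.map ((↑) : Fˣ → F), a ≠ 0 := by
  intro a ha
  obtain ⟨b, -, rfl⟩ := List.mem_map.mp ha
  exact b.ne_zero

theorem hasseIsometry {E₁ : Type v} [AddCommGroup E₁] [Module (RatFunc k) E₁]
    [FiniteDimensional (RatFunc k) E₁] {E₂ : Type w} [AddCommGroup E₂] [Module (RatFunc k) E₂]
    [FiniteDimensional (RatFunc k) E₂] {Q₁ : QuadraticForm (RatFunc k) E₁}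
    {Q₂ : QuadraticForm (RatFunc k) E₂} (h₁ : IsRegular Q₁) (h₂ : IsRegular Q₂) :
    HasseIsometry (valuationsTrivialOn k) Q₁ Q₂ := by
  intro h
  obtain ⟨w, hw, hw0⟩ := exists_isGram_diagonal Q₁ rfl
  obtain ⟨w', hw', hw0'⟩ := exists_isGram_diagonal Q₂ rfl
  refine hw.equivalent hw' (cong_diagonal_of_completions (hw0 h₁) (hw0' h₂) fun q ↦ ?_)
  obtain ⟨_⟩ := invertible_two_completion q
  exact (hw.baseChange.of_equivalent (h _ (valuation_mem_valuationsTrivialOn q))).cong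
    hw'.baseChange

theorem IsPfisterNeighbor.hasseIsotropy [FiniteDimensional (RatFunc k) E]
    {Q : QuadraticForm (RatFunc k) E} (h : IsPfisterNeighbor Q) :
    HasseIsotropy (valuationsTrivialOn k) Q := by
  obtain ⟨l, a, ⟨m, R, -, hR⟩, hdim⟩ := h
  obtain ⟨w, hw, -⟩ := exists_isGram_diagonal Q rfl
  obtain ⟨w', hw', -⟩ := exists_isGram_diagonal R rfl
  obtain ⟨ι, _, _, M, hM, hl⟩ := exists_isGram_pfister l
  refine hasseIsotropy_of_cong hw (forall_mem_map_coe_ne_zero l) a.ne_zero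
    (hM.trans ((hl.of_equivalent hR).cong ((hw.smul _).prod hw'))) ?_
  rw [hM.card_eq, hl.card_eq, hw.card_eq]
  exact hdim

theorem IsPfister.hasseIsotropy [FiniteDimensional (RatFunc k) E]
    {Q : QuadraticForm (RatFunc k) E} (h : IsPfister Q) :
    HasseIsotropy (valuationsTrivialOn k) Q := by
  obtain ⟨l, hl⟩ := h
  obtain ⟨ι, _, _, M, hM, hM'⟩ := exists_isGram_pfister l
  refine hasseIsotropy_of_cong_smul (hM'.of_equivalent hl.symm) (forall_mem_map_coe_ne_zero l)
    one_ne_zero (by rwa [one_smul]) ?_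
  rw [← hM.card_eq]
  exact card_PIdx_pos _

theorem hasseIsotropy_of_finrank_eq_two [FiniteDimensional (RatFunc k) E]
    {Q : QuadraticForm (RatFunc k) E} (hQ : IsRegular Q) (h : finrank (RatFunc k) E = 2) :
    HasseIsotropy (valuationsTrivialOn k) Q := by
  obtain ⟨w, hw, hw0⟩ := exists_isGram_diagonal Q h
  have hw0 := hw0 hQ
  exact hasseIsotropy_of_cong_smul hw (by simp [hw0]) (hw0 0) (cong_pfisterMatrix_binary hw0)
    (by simp)

theorem hasseIsotropy_of_finrank_eq_three [FiniteDimensional (RatFunc k) E]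
    {Q : QuadraticForm (RatFunc k) E} (hQ : IsRegular Q) (h : finrank (RatFunc k) E = 3) :
    HasseIsotropy (valuationsTrivialOn k) Q := by
  obtain ⟨w, hw, hw0⟩ := exists_isGram_diagonal Q h
  have hw0 := hw0 hQ
  have hc := cong_pfisterMatrix_ternary hw0
  refine hasseIsotropy_of_cong hw (by simp [hw0]) (hw0 0) hc ?_
  rw [hc.card_eq]
  simp

theorem hasseIsotropy_of_finrank_eq_four [FiniteDimensional (RatFunc k) E]
    {Q : QuadraticForm (RatFunc k) E} (hQ : IsRegular Q) (h : finrank (RatFunc k) E = 4)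
    (hdet : HasTrivialDet Q) : HasseIsotropy (valuationsTrivialOn k) Q := by
  obtain ⟨w, hw, hw0⟩ := exists_isGram_diagonal Q h
  have hw0 := hw0 hQ
  obtain ⟨b, c, hc⟩ := hdet
  -- The basis witnessing the trivial determinant need not be the orthogonal one; changing it alters
  -- the determinant by a square.
  obtain ⟨u, hu⟩ := (IsGram.cong ⟨b, rfl⟩ hw).exists_det
  have hs : w 0 * w 1 * w 2 * w 3 = (u * c) ^ 2 := by
    rw [mul_pow, ← hc, QuadraticForm.discr, ← hu, det_diagonal, Fin.prod_univ_four]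
  exact hasseIsotropy_of_cong_smul hw (by simp [hw0]) (hw0 0)
    (cong_pfisterMatrix_quaternary hw0 hs) (by simp)

end Main

end HasseQF

theorem mainTheorem5 (k : Type u) [Field k] [NeZero (2 : k)] :
    -- (a) the Hasse principle for isometry
    (∀ (E₁ : Type v) [AddCommGroup E₁] [Module (RatFunc k) E₁] [FiniteDimensional (RatFunc k) E₁]
        (E₂ : Type w) [AddCommGroup E₂] [Module (RatFunc k) E₂] [FiniteDimensional (RatFunc k) E₂]
        (Q₁ : QuadraticForm (RatFunc k) E₁) (Q₂ : QuadraticForm (RatFunc k) E₂),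
        HasseQF.IsRegular Q₁ → HasseQF.IsRegular Q₂ →
          HasseQF.HasseIsometry (HasseQF.valuationsTrivialOn k) Q₁ Q₂) ∧
    -- (b) the Hasse principle for isotropy for Pfister neighbors
    (∀ (E : Type v) [AddCommGroup E] [Module (RatFunc k) E] [FiniteDimensional (RatFunc k) E]
        (Q : QuadraticForm (RatFunc k) E),
        HasseQF.IsPfisterNeighbor Q →
          HasseQF.HasseIsotropy (HasseQF.valuationsTrivialOn k) Q) ∧
    -- (c) the Hasse principle for isotropy for Pfister forms, for regular forms of dimension
    -- 2 or 3, and for regular forms of dimension 4 with trivial determinant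
    (∀ (E : Type v) [AddCommGroup E] [Module (RatFunc k) E] [FiniteDimensional (RatFunc k) E]
        (Q : QuadraticForm (RatFunc k) E),
        (HasseQF.IsPfister Q ∨
          (HasseQF.IsRegular Q ∧
            (Module.finrank (RatFunc k) E = 2 ∨
              Module.finrank (RatFunc k) E = 3 ∨
              (Module.finrank (RatFunc k) E = 4 ∧ HasseQF.HasTrivialDet Q)))) →
          HasseQF.HasseIsotropy (HasseQF.valuationsTrivialOn k) Q) := by
  refine ⟨fun E₁ _ _ _ E₂ _ _ _ Q₁ Q₂ h₁ h₂ ↦ HasseQF.hasseIsometry h₁ h₂,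
    fun E _ _ _ Q h ↦ h.hasseIsotropy, fun E _ _ _ Q h ↦ ?_⟩
  rcases h with h | ⟨hQ, h | h | ⟨h, hdet⟩⟩
  · exact h.hasseIsotropy
  · exact HasseQF.hasseIsotropy_of_finrank_eq_two hQ h
  · exact HasseQF.hasseIsotropy_of_finrank_eq_three hQ h
  · exact HasseQF.hasseIsotropy_of_finrank_eq_four hQ h hdet
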